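/- Let $K$ be a field. A $p$-Ferrer diagram ($p\ge 1$) is a nonempty finite set $\Phi\subset(\mathbb N_{>0})^p$ such that $(i_1,\dots,i_p)\in\Phi$ and $1\le i'_k\le i_k$ for all $k$ imply $(i'_1,\dots,i'_p)\in\Phi$. Let $S_\Phi$ be the polynomial ring over $K$ in the variables $x^{(k)}_j$ such that $j$ is the $k$-th coordinate of an element of $\Phi$, and let $I_\Phi\subset S_\Phi$ be the ideal generated by the monomials $x^{(1)}_{i_1}\cdots x^{(p)}_{i_p}$, $(i_1,\dots,i_p)\in\Phi$. We say that $\Phi$ is Cohen–Macaulay of codimension $c$ if $S_\Phi/I_\Phi$ is. For an integer $\alpha\ge1$ let $\widetilde\Phi=\{(j_1,\dots,j_p) : (\lceil j_1/\alpha\rceil,\dots,\lceil j_p/\alpha\rceil)\in\Phi\}$ be the $p$-Ferrer diagram obtained by dividing each unit of length into $\alpha$ parts. The Alexander dual $I^*$ of a square-free monomial ideal $I$ is generated by the monomials $\prod_{v\in F}x_v$ for the prime ideals $(x_v : v\in F)\supseteq I$. A finitely generated graded module $M$ over a polynomial ring $S$ over $K$ has a pure resolution of type $(a_0,\dots,a_s)$,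 $a_0<\dots<a_s$, with Betti numbers $\beta_0,\dots,\beta_s>0$ if it has a minimal graded free resolution $0\to S(-a_s)^{\beta_s}\to\cdots\to S(-a_0)^{\beta_0}\to M\to0$. The Betti polynomial of $M$ is the polynomial $B_M(t)$ with $\sum_d(\dim_KM_d)\,t^d=B_M(t)/(1-t)^n$, $n=\dim S$. (1) For all integers $p,c\ge1$ there is exactly one $p$-Ferrer diagram $\Phi(p,c)$ that is Cohen–Macaulay of codimension $c$. For every integer $\alpha\ge1$, the quotient $S_{\widetilde\Phi(p,c)}/I_{\widetilde\Phi(p,c)}^*$ by the Alexander dual $I_{\widetilde\Phi(p,c)}^*$ has a pure resolution of type $(0,c\alpha,(c+1)\alpha,\dots,(c+p-1)\alpha)$. (2) Let $0<a_1<a_2$ be integers and suppose that $\beta_0-\beta_1t^{a_1}+\beta_2t^{a_2}$, with integers $\beta_0,\beta_1,\beta_2$, is the Betti polynomial of a ($\mathbb N$-graded, finitely generated) Cohen–Macaulay module of codimension $2$ over a polynomial ring in finitely many variables over $K$. Then $$\beta_1=\frac{a_2}{a_2-a_1}\beta_0,\qquad \beta_2=\frac{a_1}{a_2-a_1}\beta_0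 ,$$ and there are a positive rational number $c$ and a positive integer $\alpha$ with $a_1=c\alpha$, $a_2=(c+1)\alpha$. If $a_2-a_1$ divides $a_1$ and $a_2$, then there are positive integers $c,\alpha$ with $a_1=c\alpha$, $a_2=(c+1)\alpha$, $\beta_1=(c+1)\beta_0$, $\beta_2=c\beta_0$. (3) For all integers $c,\alpha,\beta_0\ge1$, the direct sum of $\beta_0$ copies of $S_{\widetilde\Phi(2,c)}/I_{\widetilde\Phi(2,c)}^*$ has a pure resolution of type $(0,c\alpha,(c+1)\alpha)$, with Betti numbers $\beta_0,(c+1)\beta_0,c\beta_0$. -/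

import Mathlib

open MvPolynomial

noncomputable section

section GradedModules

variable {K : Type*} [Field K] {σ : Type*}
  {M : Type*} [AddCommGroup M] [Module K M] [Module (MvPolynomial σ K) M]

variable (σ) in
/-- A module `M` over `S = K[x_v : v ∈ σ]`, with homogeneous components `ℳ d`, has a pure
(minimal graded free) resolution of length `s` and type `(a 0, a 1, …, a s)`, with Betti numbers
`β 0, …, β s`:
`0 → S(-a s)^(β s) → ⋯ → S(-a 1)^(β 1) → S(-a 0)^(β 0) → M → 0`.
The maps between the free modules are matrices whose entries are forms of degree
`a (i + 1) - a i > 0`; in particular these entries lie in the ideal of the variables, so that the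
resolution is minimal. Only `a 0, …, a s` matter, and `β i = 0` for `i > s`. -/
def HasPureResolution (ℳ : ℕ → Submodule K M) (s : ℕ) (a β : ℕ → ℕ) : Prop :=
  (∀ i < s, a i < a (i + 1)) ∧
  (∀ i, 0 < β i ↔ i ≤ s) ∧
  ∃ (A : ∀ i : ℕ, Matrix (Fin (β i)) (Fin (β (i + 1))) (MvPolynomial σ K))
    (ε : (Fin (β 0) → MvPolynomial σ K) →ₗ[MvPolynomial σ K] M),
    (∀ i k j, (A i k j).IsHomogeneous (a (i + 1) - a i)) ∧
    (∀ j, ε (Pi.single j 1) ∈ ℳ (a 0)) ∧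
    Function.Surjective ε ∧
    Function.Exact (A 0).mulVecLin ε ∧
    ∀ i, Function.Exact (A (i + 1)).mulVecLin (A i).mulVecLin

/-- The Hilbert series `∑ d, (dim_K M_d) t ^ d`. -/
def hilbertSeries (ℳ : ℕ → Submodule K M) : PowerSeries ℤ :=
  PowerSeries.mk fun d => (Module.finrank K (ℳ d) : ℤ)

/-- `B` is the Betti polynomial of a graded module over a polynomial ring in `n = |σ|` variables:
the numerator of the Hilbert series `B(t) / (1 - t) ^ n`. -/
def IsBettiPolynomial (σ : Type*) (ℳ : ℕ → Submodule K M) (B : Polynomial ℤ) : Prop :=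
  hilbertSeries ℳ * (1 - PowerSeries.X) ^ Nat.card σ = (B : PowerSeries ℤ)

variable (K σ M) in
/-- `M` has codimension `c`, that is `dim M = dim S - c`, over `S = K[x_v : v ∈ σ]`. -/
def HasCodim (c : ℕ) : Prop :=
  Module.supportDim (MvPolynomial σ K) M + (c : WithBot ℕ∞) = (Nat.card σ : WithBot ℕ∞)

variable (K σ M) in
/-- A finitely generated graded module over `S = K[x_v : v ∈ σ]` is Cohen–Macaulay if its depth
(the length of a longest regular sequence in the ideal of the variables) equals its dimension:
there is a regular sequence in that ideal whose length is the dimension of `M`. -/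
def IsGradedCohenMacaulay : Prop :=
  ∃ rs : List (MvPolynomial σ K),
    (∀ r ∈ rs, r ∈ Ideal.span (Set.range (X : σ → MvPolynomial σ K))) ∧
    RingTheory.Sequence.IsRegular M rs ∧
    Module.supportDim (MvPolynomial σ K) M = (rs.length : WithBot ℕ∞)

end GradedModules

section QuotientsByIdeals

variable {K : Type*} [Field K] {σ : Type*}

/-- The grading of `S / I` (for `I` homogeneous) induced by the standard grading of `S`. -/
def quotientGrading (I : Ideal (MvPolynomial σ K)) (d : ℕ) :
    Submodule K (MvPolynomial σ K ⧸ I) :=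
  (homogeneousSubmodule σ K d).map (Ideal.Quotient.mkₐ K I).toLinearMap

/-- The induced grading of the direct sum of `b` copies of `S / I`. -/
def copiesGrading (I : Ideal (MvPolynomial σ K)) (b d : ℕ) :
    Submodule K (Fin b → MvPolynomial σ K ⧸ I) :=
  Submodule.pi Set.univ fun _ => quotientGrading I d

/-- The Alexander dual of a square-free monomial ideal `I`: it is generated by the monomials
`∏ v ∈ F, x_v`, where `F` runs over the finite sets of variables such that the prime ideal
`(x_v : v ∈ F)` contains `I` (the minimal ones among these primes being the components of the
prime decomposition of `I`, which already give a system of generators). -/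
def alexanderDual (I : Ideal (MvPolynomial σ K)) : Ideal (MvPolynomial σ K) :=
  Ideal.span {m | ∃ F : Finset σ, I ≤ Ideal.span (X '' (F : Set σ)) ∧ m = ∏ v ∈ F, X v}

end QuotientsByIdeals

/-- A `p`-Ferrer diagram: a nonempty finite set of boxes in `ℕ ^ p` such that with each box all
boxes with smaller or equal labels belong to it. Labels start from `0` here: the box `i` is the box
usually labelled `(i_1 + 1, …, i_p + 1)`. -/
structure FerrerDiagram (p : ℕ) where
  boxes : Set (Fin p → ℕ)
  finite : boxes.Finite
  nonempty : boxes.Nonempty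
  isLowerSet : IsLowerSet boxes

namespace FerrerDiagram

variable {p : ℕ} (Φ : FerrerDiagram p)

/-- The variables `x_j^{(k)}` of the polynomial ring of `Φ`: the pairs `(k, j)` such that `j` is the
`k`-th label of some box of `Φ`. -/
def Var : Type :=
  {v : Fin p × ℕ // ∃ i ∈ Φ.boxes, i v.1 = v.2}

instance : Finite Φ.Var := by
  have h : ((fun q : (Fin p → ℕ) × Fin p => (q.2, q.1 q.2)) ''
      (Φ.boxes ×ˢ (Set.univ : Set (Fin p)))).Finite :=
    (Φ.finite.prod Set.finite_univ).image _
  refine (h.subset ?_ : {v : Fin p × ℕ | ∃ i ∈ Φ.boxes, i v.1 = v.2}.Finite).to_subtype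
  rintro ⟨k, j⟩ ⟨i, hi, hij⟩
  exact ⟨(i, k), ⟨hi, Set.mem_univ _⟩, Prod.ext rfl hij⟩

/-- The `k`-th variable `x_{i_k}^{(k)}` of a box `i` of `Φ`. -/
def boxVar (i : Φ.boxes) (k : Fin p) : Φ.Var :=
  ⟨(k, i.1 k), i.1, i.2, rfl⟩

/-- The `p`-Ferrer ideal `I_Φ`, generated by the monomials `∏ k, x_{i_k}^{(k)}` for the boxes `i`
of `Φ`. -/
def ideal (K : Type*) [Field K] : Ideal (MvPolynomial Φ.Var K) :=
  Ideal.span (Set.range fun i : Φ.boxes => ∏ k, X (Φ.boxVar i k))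

/-- `Φ` is Cohen–Macaulay of codimension `c` (over `K`): `S / I_Φ` is. -/
def IsCohenMacaulayOfCodim (K : Type*) [Field K] (c : ℕ) : Prop :=
  IsGradedCohenMacaulay K Φ.Var (MvPolynomial Φ.Var K ⧸ Φ.ideal K) ∧
    HasCodim K Φ.Var (MvPolynomial Φ.Var K ⧸ Φ.ideal K) c

/-- The diagram obtained from `Φ` by dividing each unit of length into `α` parts: the box `i` of `Φ`
is replaced by the `α ^ p` boxes `j` with `α * i_k ≤ j_k < α * i_k + α` for all `k`. -/
def subdivide (α : ℕ) (hα : 0 < α) : FerrerDiagram p where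
  boxes := {j | (fun k => j k / α) ∈ Φ.boxes}
  finite := by
    refine Φ.finite.preimage' (f := fun (j : Fin p → ℕ) k => j k / α) fun i _ => ?_
    refine (Set.finite_Iic fun k => α * i k + α).subset ?_
    intro j hj k
    have h : j k / α = i k := congrFun hj k
    have h2 := Nat.div_add_mod (j k) α
    have h3 := Nat.mod_lt (j k) hα
    rw [h] at h2
    show j k ≤ α * i k + α
    omega
  nonempty := by
    obtain ⟨i, hi⟩ := Φ.nonempty
    refine ⟨fun k => α * i k, ?_⟩
    simpa [Nat.mul_div_cancel_left _ hα] using hi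
  isLowerSet := fun _ _ hij hi => Φ.isLowerSet (fun k => Nat.div_le_div_right (hij k)) hi

end FerrerDiagram

end

/-! With labels starting from 0, the diagram Φ(p,c) is the simplex of all boxes with label sum less
than c. The first label is called the colour of a variable.

Uniqueness. For m outside Φ, the variables with label below m_k in colour k generate a prime
containing I_Φ, so codimension c forces c ≤ ∑ m_k and the simplex lies in Φ (`le_sum_of_hasCodim`).
Conversely, let b be a box with ∑ b_k ≥ c, and let W be the set of variables with label at most b_k
in colour k. Split the Koszul differential by colours and apply the differentials of all colours but
one to the basis element e_W. Modulo I_Φ this is a cycle of homological degree ∑ b_k + 1 > c. Were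
it a boundary, a monomial of degree p would lie in 𝔪 I_Φ up to terms with other monomials, but I_Φ
starts in degree p (`not_exists_koszulD_eq`). Depth n - c, with n the number of variables, forbids
such a class (`exists_koszulD_eq`).

Existence. For a variable z of the last colour, the shifted simplex ideal is I = zA + B with B ⊆ A,
I : z = A and I + (z) = B + (z), and A, B are again of this kind. Regular sequences pass from the
outer terms to S/I (`IdealRegular.of_colon`), and the elementary symmetric polynomials of degrees n
- c, …, 1 serve at once for all quotients by c variables at which the induction ends.

Resolution. The dual of the subdivided simplex is generated by products of initial runs of blocks of
α variables, with c blocks in all (`alexanderDual_subdivide_simplex`). Splitting off the first block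
z of the last colour writes the ideal as A + zB with A ⊆ B and z regular modulo A. The sequence 0 →
A → A ⊕ B → A + zB → 0, a ↦ (za, -a), gives a mapping cone whose matrices again have entries of
degree α (`exists_cone`). For p = 2 the Betti numbers are 1, c + 1, c.

Betti polynomials. Noether normalization bounds the summed Hilbert function by a polynomial of
degree at most dim M = n - 2, whence (t - 1)² divides B_M (`sub_one_pow_dvd_of_sum_le`). The
equations B_M(1) = B_M'(1) = 0 determine β₁ and β₂ from β₀. -/

/-! ### Monomial ideals -/

section MonomialIdeals

variable {K : Type*} [Field K] {σ : Type*}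

/-- The ideal generated by the monomials with exponents in `s`. -/
noncomputable def monomialIdeal (K : Type*) [Field K] {σ : Type*} (s : Set (σ →₀ ℕ)) :
    Ideal (MvPolynomial σ K) :=
  Ideal.span ((fun m => monomial m (1 : K)) '' s)

theorem mem_monomialIdeal {s : Set (σ →₀ ℕ)} {f : MvPolynomial σ K} :
    f ∈ monomialIdeal K s ↔ ∀ m ∈ f.support, ∃ e ∈ s, e ≤ m :=
  mem_ideal_span_monomial_image

theorem monomialIdeal_mono {s t : Set (σ →₀ ℕ)} (h : ∀ m ∈ s, ∃ e ∈ t, e ≤ m) :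
    monomialIdeal K s ≤ monomialIdeal K t := by
  intro f hf
  rw [mem_monomialIdeal] at hf ⊢
  intro m hm
  obtain ⟨e, he, hem⟩ := hf m hm
  obtain ⟨e', he', h'⟩ := h e he
  exact ⟨e', he', h'.trans hem⟩

theorem monomialIdeal_union (s t : Set (σ →₀ ℕ)) :
    monomialIdeal K (s ∪ t) = monomialIdeal K s ⊔ monomialIdeal K t := by
  rw [monomialIdeal, Set.image_union, Ideal.span_union]; rfl

theorem monomialIdeal_empty : monomialIdeal K (∅ : Set (σ →₀ ℕ)) = ⊥ := by
  simp [monomialIdeal]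

theorem monomialIdeal_singleton_zero : monomialIdeal K ({0} : Set (σ →₀ ℕ)) = ⊤ := by
  rw [Ideal.eq_top_iff_one, mem_monomialIdeal]
  exact fun m _ => ⟨0, rfl, zero_le⟩

theorem monomialIdeal_add_image (e : σ →₀ ℕ) (s : Set (σ →₀ ℕ)) :
    monomialIdeal K ((e + ·) '' s) = Ideal.span {monomial e (1 : K)} * monomialIdeal K s := by
  rw [monomialIdeal, monomialIdeal, Ideal.span_mul_span', Set.singleton_mul, Set.image_image,
    Set.image_image]
  simp [monomial_mul]

/-- A monomial whose variables do not occur in the generators of a monomial ideal is a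
nonzerodivisor modulo this ideal. -/
theorem mem_monomialIdeal_of_monomial_mul_mem {s : Set (σ →₀ ℕ)} {e : σ →₀ ℕ}
    (h : ∀ m ∈ s, Disjoint m e) {f : MvPolynomial σ K}
    (hf : monomial e (1 : K) * f ∈ monomialIdeal K s) : f ∈ monomialIdeal K s := by
  rw [mem_monomialIdeal] at hf ⊢
  intro m hm
  obtain ⟨d, hd, hdm⟩ := hf (e + m) (by
    rw [mem_support_iff, coeff_monomial_mul, one_mul]
    exact mem_support_iff.mp hm)
  refine ⟨d, hd, fun v => ?_⟩
  have h1 := hdm v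
  have h2 : min (d v) (e v) = 0 := by
    have := DFunLike.congr_fun ((h d hd).eq_bot) v
    exact this
  simp only [Finsupp.add_apply] at h1
  omega

theorem span_X_image (Z : Set σ) :
    Ideal.span (X '' Z : Set (MvPolynomial σ K)) =
      monomialIdeal K ((fun v => Finsupp.single v 1) '' Z) := by
  rw [monomialIdeal, Set.image_image]; rfl

end MonomialIdeals

/-! ### Exponents of the simplex ideal and of its dual -/

section Exponents

variable {σ : Type*} (E : ℕ → ℕ → σ →₀ ℕ)

/-- The exponents of the generators of the Ferrers ideal of the diagram of all boxes `i` with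
`∑ k, i k < c`, where `E k a` stands for the variable with labels `k`, `a`. -/
def simplexExponents (p c : ℕ) : Set (σ →₀ ℕ) :=
  {m | ∃ i : Fin p → ℕ, (∑ k, i k) < c ∧ m = ∑ k : Fin p, E k (i k)}

/-- The exponents of `simplexExponents E (p + 1) c`, with the last label shifted by `s`. -/
def shiftedSimplexExponents (p c s : ℕ) : Set (σ →₀ ℕ) :=
  {m | ∃ a < c, ∃ e ∈ simplexExponents E p (c - a), m = E p (a + s) + e}

theorem simplexExponents_succ (p c : ℕ) :
    simplexExponents E (p + 1) c = shiftedSimplexExponents E p c 0 := by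
  ext m
  constructor
  · rintro ⟨i, hi, rfl⟩
    rw [Fin.sum_univ_castSucc] at hi ⊢
    refine ⟨i (Fin.last p), by omega, _, ⟨fun k => i k.castSucc, by beta_reduce; omega, rfl⟩, ?_⟩
    simp [add_comm]
  · rintro ⟨a, ha, _, ⟨i, hi, rfl⟩, rfl⟩
    refine ⟨Fin.snoc i a, ?_, ?_⟩ <;> rw [Fin.sum_univ_castSucc]
    · simp; omega
    · simp [add_comm]

theorem simplexExponents_zero_right (p : ℕ) : simplexExponents E p 0 = ∅ := by
  ext m; simp [simplexExponents]

theorem simplexExponents_zero_left (c : ℕ) : simplexExponents E 0 (c + 1) = {0} := by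
  ext m; simp [simplexExponents]

theorem shiftedSimplexExponents_zero (p s : ℕ) : shiftedSimplexExponents E p 0 s = ∅ := by
  ext m; simp [shiftedSimplexExponents]

/-- Generators with last label s against those with a larger one: this is the decomposition I = zA +
B used for regular sequences. -/
theorem shiftedSimplexExponents_succ (p c s : ℕ) :
    shiftedSimplexExponents E p (c + 1) s =
      (E p s + ·) '' simplexExponents E p (c + 1) ∪ shiftedSimplexExponents E p c (s + 1) := by
  ext m
  constructor
  · rintro ⟨a, ha, e, he, rfl⟩
    rcases a with _ | a
    · exact Or.inl ⟨e, he, by simp⟩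
    · refine Or.inr ⟨a, by omega, e, ?_, by rw [add_assoc, add_comm 1 s]⟩
      rwa [Nat.add_sub_add_right] at he
  · rintro (⟨e, he, rfl⟩ | ⟨a, ha, e, he, rfl⟩)
    · exact ⟨0, by omega, e, he, by simp⟩
    · exact ⟨a + 1, by omega, e, by rwa [Nat.add_sub_add_right],
        by rw [add_assoc, add_comm 1 s]⟩

theorem simplexExponents_mono (p : ℕ) {c d : ℕ} (h : c ≤ d) :
    simplexExponents E p c ⊆ simplexExponents E p d := by
  rintro m ⟨i, hi, rfl⟩
  exact ⟨i, by omega, rfl⟩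

/-- The exponents of the products of initial variables `∏ k, ∏ a < m k, E k a` with
`∑ k, m k = c`. -/
def dualExponents (p c : ℕ) : Set (σ →₀ ℕ) :=
  {e | ∃ m : Fin p → ℕ, ∑ k, m k = c ∧ e = ∑ k, ∑ a ∈ Finset.range (m k), E k a}

/-- The exponents of `dualExponents E (p + 1) c`, with the last label shifted by `s`. -/
def shiftedDualExponents (p c s : ℕ) : Set (σ →₀ ℕ) :=
  {e | ∃ b ≤ c, ∃ d ∈ dualExponents E p (c - b), e = d + ∑ a ∈ Finset.range b, E p (a + s)}

theorem dualExponents_succ (p c : ℕ) :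
    dualExponents E (p + 1) c = shiftedDualExponents E p c 0 := by
  ext e
  constructor
  · rintro ⟨m, hm, rfl⟩
    rw [Fin.sum_univ_castSucc] at hm ⊢
    exact ⟨m (Fin.last p), by omega, _, ⟨fun k => m k.castSucc, by beta_reduce; omega, rfl⟩,
      by simp⟩
  · rintro ⟨b, hb, _, ⟨m, hm, rfl⟩, rfl⟩
    refine ⟨Fin.snoc m b, ?_, ?_⟩ <;> rw [Fin.sum_univ_castSucc]
    · simp; omega
    · simp

theorem dualExponents_zero_right (p : ℕ) : dualExponents E p 0 = {0} := by
  ext e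
  simp only [dualExponents, Finset.sum_eq_zero_iff, Finset.mem_univ, true_imp_iff,
    Set.mem_ofPred_eq, Set.mem_singleton_iff]
  constructor
  · rintro ⟨m, hm, rfl⟩
    simp [hm]
  · rintro rfl
    exact ⟨fun _ => 0, by simp⟩

theorem dualExponents_zero_left (c : ℕ) : dualExponents E 0 (c + 1) = ∅ := by
  ext m; simp [dualExponents]

theorem shiftedDualExponents_zero (p s : ℕ) : shiftedDualExponents E p 0 s = {0} := by
  ext m; simp [shiftedDualExponents, dualExponents_zero_right]

/-- The run in the last colour is either empty or starts with the block s: this is the decomposition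
A + zB resolved by a mapping cone. -/
theorem shiftedDualExponents_succ (p c s : ℕ) :
    shiftedDualExponents E p (c + 1) s =
      dualExponents E p (c + 1) ∪ (E p s + ·) '' shiftedDualExponents E p c (s + 1) := by
  ext e
  constructor
  · rintro ⟨b, hb, d, hd, rfl⟩
    rcases b with _ | b
    · exact Or.inl (by simpa using hd)
    · refine Or.inr ⟨_, ⟨b, by omega, d, ?_, rfl⟩, ?_⟩
      · rwa [Nat.add_sub_add_right] at hd
      · simp only [Finset.sum_range_succ', zero_add, add_assoc, add_comm 1 s]
        abel
  · rintro (hd | ⟨_, ⟨b, hb, d, hd, rfl⟩, rfl⟩)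
    · exact ⟨0, by omega, e, by simpa using hd, by simp⟩
    · refine ⟨b + 1, by omega, d, by rwa [Nat.add_sub_add_right], ?_⟩
      simp only [Finset.sum_range_succ', zero_add, add_assoc, add_comm 1 s]
      abel

theorem dualExponents_subset_shifted (p c s : ℕ) :
    dualExponents E p c ⊆ shiftedDualExponents E p c s :=
  fun e he => ⟨0, by omega, e, by simpa using he, by simp⟩

/-- Shortening a nonempty run by its last block. This yields the inclusion A ⊆ B needed for the
cone. -/
theorem exists_le_of_mem_dualExponents_succ {p c : ℕ} {e : σ →₀ ℕ}
    (he : e ∈ dualExponents E p (c + 1)) : ∃ d ∈ dualExponents E p c, d ≤ e := by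
  obtain ⟨m, hm, rfl⟩ := he
  obtain ⟨k, -, hk⟩ : ∃ k ∈ Finset.univ, m k ≠ 0 :=
    Finset.exists_ne_zero_of_sum_ne_zero (by omega)
  refine ⟨_, ⟨Function.update m k (m k - 1), ?_, rfl⟩, ?_⟩
  · rw [Finset.sum_update_of_mem (Finset.mem_univ k)]
    rw [← Finset.add_sum_erase _ _ (Finset.mem_univ k), ← Finset.sdiff_singleton_eq_erase] at hm
    omega
  · refine Finset.sum_le_sum fun l _ => Finset.sum_le_sum_of_subset ?_
    rw [Finset.range_subset_range]
    by_cases h : l = k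
    · subst h; simp
    · simp [h]

/-- The first p colours do not involve colour p, so z is a nonzerodivisor modulo A. -/
theorem disjoint_of_mem_dualExponents (hE : ∀ k l a b, k ≠ l → Disjoint (E k a) (E l b))
    {p c : ℕ} {e : σ →₀ ℕ} (he : e ∈ dualExponents E p c) (s : ℕ) : Disjoint e (E p s) := by
  obtain ⟨m, -, rfl⟩ := he
  classical
  rw [Finsupp.disjoint_iff]
  refine Finset.disjoint_left.mpr fun v hv hv' => ?_
  obtain ⟨k, -, hk⟩ := Finset.mem_biUnion.mp (Finsupp.support_finsetSum hv)
  obtain ⟨a, -, ha⟩ := Finset.mem_biUnion.mp (Finsupp.support_finsetSum hk)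
  have := Finsupp.disjoint_iff.mp (hE k p a s (by have := k.2; omega))
  exact Finset.disjoint_left.mp this ha hv'

end Exponents

/-! ### Linear resolutions and mapping cones -/

section LinearResolutions

open Matrix

variable {K : Type*} [Field K] {σ : Type*}

/-- A free resolution `⋯ → S(-g-α)^(ι 1) → S(-g)^(ι 0) → I → 0` of an ideal, given by matrices
whose entries are forms of degree `α`, and with generators of degree `g`. -/
structure LinearResolution (I : Ideal (MvPolynomial σ K)) (g α : ℕ) where
  ι : ℕ → Type
  fin : ∀ i, Fintype (ι i)
  a : Matrix Unit (ι 0) (MvPolynomial σ K)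
  d : ∀ i, Matrix (ι i) (ι (i + 1)) (MvPolynomial σ K)
  a_hom : ∀ u j, (a u j).IsHomogeneous g
  d_hom : ∀ i k j, (d i k j).IsHomogeneous α
  mem_iff : ∀ f, f ∈ I ↔ ∃ x, a *ᵥ x = fun _ => f
  exact_zero : ∀ x, a *ᵥ x = 0 ↔ ∃ y, d 0 *ᵥ y = x
  exact_succ : ∀ i x, d i *ᵥ x = 0 ↔ ∃ y, d (i + 1) *ᵥ y = x

attribute [instance] LinearResolution.fin

theorem MvPolynomial.IsHomogeneous.homogeneousComponent_mul {f : MvPolynomial σ K} {a : ℕ}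
    (hf : f.IsHomogeneous a) (g : MvPolynomial σ K) (b : ℕ) :
    homogeneousComponent (a + b) (f * g) = f * homogeneousComponent b g := by
  let := MvPolynomial.gradedAlgebra (σ := σ) (R := K)
  have h := DirectSum.coe_decompose_mul_add_of_left_mem (homogeneousSubmodule σ K) (i := a)
    (j := b) (a := f) (b := g) ((mem_homogeneousSubmodule _ _).mpr hf)
  rw [← decomposition.decompose'_apply, ← decomposition.decompose'_apply]
  exact h

/-- A solution of a homogeneous linear system can be chosen homogeneous. -/
theorem exists_homogeneous_mul_eq {κ ι τ : Type*} [Fintype ι]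
    {A : Matrix κ ι (MvPolynomial σ K)} {B : Matrix κ τ (MvPolynomial σ K)} {a b : ℕ}
    (hA : ∀ i j, (A i j).IsHomogeneous a) (hB : ∀ i j, (B i j).IsHomogeneous (a + b))
    (h : ∀ t, ∃ x, A *ᵥ x = fun k => B k t) :
    ∃ X : Matrix ι τ (MvPolynomial σ K), (∀ i j, (X i j).IsHomogeneous b) ∧ A * X = B := by
  choose x hx using h
  refine ⟨Matrix.of fun i t => homogeneousComponent b (x t i),
    fun i j => homogeneousComponent_isHomogeneous _ _, ?_⟩
  ext1 k t
  have h := congrArg (homogeneousComponent (a + b)) (congrFun (hx t) k)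
  rw [homogeneousComponent_of_mem ((mem_homogeneousSubmodule _ _).mpr (hB k t)), if_pos rfl] at h
  rw [← h, Matrix.mul_apply, mulVec, dotProduct, map_sum]
  exact Finset.sum_congr rfl fun j _ => ((hA k j).homogeneousComponent_mul _ _).symm

theorem isHomogeneous_matrix_mul {κ ι τ : Type*} [Fintype ι]
    {A : Matrix κ ι (MvPolynomial σ K)} {B : Matrix ι τ (MvPolynomial σ K)} {a b : ℕ}
    (hA : ∀ i j, (A i j).IsHomogeneous a) (hB : ∀ i j, (B i j).IsHomogeneous b) (k : κ) (t : τ) :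
    ((A * B) k t).IsHomogeneous (a + b) :=
  IsHomogeneous.sum _ _ _ fun j _ => (hA k j).mul (hB j t)

namespace LinearResolution

variable {I A B : Ideal (MvPolynomial σ K)} {g α : ℕ}

theorem a_mul_d (P : LinearResolution I g α) : P.a * P.d 0 = 0 := by
  classical
  refine ext_of_mulVec_single fun j => ?_
  rw [← mulVec_mulVec, zero_mulVec]
  exact (P.exact_zero _).mpr ⟨_, rfl⟩

theorem d_mul_d (P : LinearResolution I g α) (i : ℕ) : P.d i * P.d (i + 1) = 0 := by
  classical
  refine ext_of_mulVec_single fun j => ?_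
  rw [← mulVec_mulVec, zero_mulVec]
  exact (P.exact_succ _ _).mpr ⟨_, rfl⟩

/-- An inclusion of ideals lifts to a homogeneous map of linear resolutions. -/
theorem exists_lift (P : LinearResolution A (g + α) α) (Q : LinearResolution B g α)
    (h : A ≤ B) : ∃ φ : ∀ i, Matrix (Q.ι i) (P.ι i) (MvPolynomial σ K),
      (∀ i k j, (φ i k j).IsHomogeneous α) ∧ Q.a * φ 0 = P.a ∧
      ∀ i, Q.d i * φ (i + 1) = φ i * P.d i := by
  classical
  have h0 : ∃ φ : Matrix (Q.ι 0) (P.ι 0) (MvPolynomial σ K),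
      (∀ k j, (φ k j).IsHomogeneous α) ∧ Q.a * φ = P.a := by
    refine exists_homogeneous_mul_eq Q.a_hom P.a_hom fun t => ?_
    exact (Q.mem_iff (P.a () t)).mp (h ((P.mem_iff _).mpr ⟨Pi.single t 1, by
      rw [mulVec_single_one]; rfl⟩))
  obtain ⟨φ₀, h₀, e₀⟩ := h0
  -- Each lift carries the property that makes the next one exist: composed with the differential of
  -- P, it lands in the image of that of Q.
  let T (i : ℕ) := {φ : Matrix (Q.ι i) (P.ι i) (MvPolynomial σ K) //
    (∀ k j, (φ k j).IsHomogeneous α) ∧ ∀ y, ∃ x, Q.d i *ᵥ x = φ *ᵥ (P.d i *ᵥ y)}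
  have step : ∀ i (φ : T i), ∃ ψ : T (i + 1), Q.d i * ψ.1 = φ.1 * P.d i := by
    rintro i ⟨φ, hφ, hy⟩
    obtain ⟨ψ, hψ, e⟩ := exists_homogeneous_mul_eq (Q.d_hom i)
      (isHomogeneous_matrix_mul hφ (P.d_hom i)) (fun t => by
        obtain ⟨x, hx⟩ := hy (Pi.single t 1)
        refine ⟨x, hx.trans ?_⟩
        rw [mulVec_mulVec, mulVec_single_one]; rfl)
    refine ⟨⟨ψ, hψ, fun y => (Q.exact_succ i _).mp ?_⟩, e⟩
    rw [mulVec_mulVec, mulVec_mulVec, e, Matrix.mul_assoc, P.d_mul_d,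
      Matrix.mul_zero, zero_mulVec]
  choose next hnext using step
  let t0 : T 0 := ⟨φ₀, h₀, fun y => (Q.exact_zero _).mp (by
    rw [mulVec_mulVec, mulVec_mulVec, e₀, P.a_mul_d, zero_mulVec])⟩
  let seq : ∀ i, T i := fun i => Nat.rec t0 (fun i φ => next i φ) i
  exact ⟨fun i => (seq i).1, fun i => (seq i).2.1, e₀, fun i => hnext i (seq i)⟩

/-- The index types of a resolution, shifted by one. -/
def shiftIndex (P : LinearResolution I g α) : ℕ → Type
  | 0 => Empty
  | i + 1 => P.ι i

instance (P : LinearResolution I g α) : ∀ i, Fintype (P.shiftIndex i)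
  | 0 => inferInstanceAs (Fintype Empty)
  | i + 1 => inferInstanceAs (Fintype (P.ι i))

/-- The differentials of a resolution, shifted by one. -/
def shiftD (P : LinearResolution I g α) :
    ∀ i, Matrix (P.shiftIndex i) (P.shiftIndex (i + 1)) (MvPolynomial σ K)
  | 0 => fun k => k.elim
  | i + 1 => P.d i

theorem shiftD_hom (P : LinearResolution I g α) : ∀ i k j, (P.shiftD i k j).IsHomogeneous α
  | 0 => fun k => k.elim
  | i + 1 => P.d_hom i

/-- A vector over `P.ι i`, as a vector over `P.shiftIndex (i + 1)`. -/
def shiftVec (P : LinearResolution I g α) {i : ℕ} (w : P.ι i → MvPolynomial σ K) :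
    P.shiftIndex (i + 1) → MvPolynomial σ K := w

/-- A matrix with columns indexed by `P.ι i`, with columns indexed by `P.shiftIndex (i + 1)`. -/
def shiftCols (P : LinearResolution I g α) {κ : Type*} {i : ℕ}
    (m : Matrix κ (P.ι i) (MvPolynomial σ K)) :
    Matrix κ (P.shiftIndex (i + 1)) (MvPolynomial σ K) := m

theorem shiftVec_surjective (P : LinearResolution I g α) {i : ℕ}
    (w : P.shiftIndex (i + 1) → MvPolynomial σ K) : ∃ w', w = P.shiftVec w' := ⟨w, rfl⟩

theorem shiftCols_mulVec (P : LinearResolution I g α) {κ : Type*} {i : ℕ}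
    (m : Matrix κ (P.ι i) (MvPolynomial σ K)) (w : P.ι i → MvPolynomial σ K) :
    P.shiftCols m *ᵥ P.shiftVec w = m *ᵥ w := rfl

theorem shiftD_succ_mulVec (P : LinearResolution I g α) {i : ℕ}
    (w : P.ι (i + 1) → MvPolynomial σ K) :
    P.shiftD (i + 1) *ᵥ P.shiftVec w = P.shiftVec (P.d i *ᵥ w) := rfl

theorem shiftVec_neg (P : LinearResolution I g α) {i : ℕ} (w : P.ι i → MvPolynomial σ K) :
    P.shiftVec (-w) = -P.shiftVec w := rfl

theorem shiftVec_eq_zero (P : LinearResolution I g α) {i : ℕ} {w : P.ι i → MvPolynomial σ K} :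
    P.shiftVec w = 0 ↔ w = 0 := Iff.rfl

theorem shiftVec_inj (P : LinearResolution I g α) {i : ℕ} {w w' : P.ι i → MvPolynomial σ K} :
    P.shiftVec w = P.shiftVec w' ↔ w = w' := Iff.rfl

attribute [irreducible] shiftVec

theorem shiftD_mulVec_d (P : LinearResolution I g α) :
    ∀ (i : ℕ) (w : P.ι (i + 1) → MvPolynomial σ K),
      P.shiftD i *ᵥ P.shiftVec (P.d i *ᵥ w) = 0
  | 0, w => by ext k; exact k.elim
  | i + 1, w => by
    rw [shiftD_succ_mulVec, shiftVec_eq_zero]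
    exact (P.exact_succ _ _).mpr ⟨w, rfl⟩

open Classical in
/-- The differential of the mapping cone which resolves `A + z B`. -/
noncomputable def coneD (P : LinearResolution A (g + α) α) (Q : LinearResolution B g α)
    (z : MvPolynomial σ K) (φ : ∀ i, Matrix (Q.ι i) (P.ι i) (MvPolynomial σ K)) (i : ℕ) :
    Matrix ((P.ι i ⊕ Q.ι i) ⊕ P.shiftIndex i)
      ((P.ι (i + 1) ⊕ Q.ι (i + 1)) ⊕ P.shiftIndex (i + 1)) (MvPolynomial σ K) :=
  fromBlocks (fromBlocks (P.d i) 0 0 (Q.d i))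
    (P.shiftCols (fromRows (z • (1 : Matrix (P.ι i) (P.ι i) (MvPolynomial σ K))) (-φ i)))
    0 (-P.shiftD i)

/-- The terms z • w and -φ w lift the embedding a ↦ (za, -a) of A into A ⊕ B; all exactness
computations for the cone use this form. -/
theorem coneD_mulVec (P : LinearResolution A (g + α) α) (Q : LinearResolution B g α)
    (z : MvPolynomial σ K) (φ : ∀ i, Matrix (Q.ι i) (P.ι i) (MvPolynomial σ K)) (i : ℕ)
    (x : P.ι (i + 1) → MvPolynomial σ K) (y : Q.ι (i + 1) → MvPolynomial σ K)
    (w : P.ι i → MvPolynomial σ K) :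
    coneD P Q z φ i *ᵥ Sum.elim (Sum.elim x y) (P.shiftVec w) =
      Sum.elim (Sum.elim (P.d i *ᵥ x + z • w) (Q.d i *ᵥ y - φ i *ᵥ w))
        (-(P.shiftD i *ᵥ P.shiftVec w)) := by
  classical
  rw [coneD, fromBlocks_mulVec, Sum.elim_comp_inl, Sum.elim_comp_inr, fromBlocks_mulVec,
    shiftCols_mulVec, fromRows_mulVec, neg_mulVec, neg_mulVec, smul_mulVec, one_mulVec,
    zero_mulVec (Sum.elim x y), zero_add]
  congr 1
  ext1 (j | j) <;> simp [sub_eq_add_neg]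

theorem exists_sum_elim {ι κ τ : Type*} {R : Type*} (v : (ι ⊕ κ) ⊕ τ → R) :
    ∃ x y w, v = Sum.elim (Sum.elim x y) w :=
  ⟨fun i => v (.inl (.inl i)), fun i => v (.inl (.inr i)), fun i => v (.inr i), by
    ext ((_ | _) | _) <;> rfl⟩

theorem sum_elim_inj {ι κ τ : Type*} {R : Type*} {x x' : ι → R} {y y' : κ → R} {w w' : τ → R} :
    Sum.elim (Sum.elim x y) w = Sum.elim (Sum.elim x' y') w' ↔ x = x' ∧ y = y' ∧ w = w' := by
  refine ⟨fun h => ⟨?_, ?_, ?_⟩, by rintro ⟨rfl, rfl, rfl⟩; rfl⟩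
  · ext i; exact congrFun h (.inl (.inl i))
  · ext i; exact congrFun h (.inl (.inr i))
  · ext i; exact congrFun h (.inr i)

theorem sum_elim_eq_zero {ι κ τ : Type*} {R : Type*} [Zero R] {x : ι → R} {y : κ → R}
    {w : τ → R} : Sum.elim (Sum.elim x y) w = 0 ↔ x = 0 ∧ y = 0 ∧ w = 0 := by
  rw [← sum_elim_inj]
  have : (Sum.elim (Sum.elim 0 0) 0 : (ι ⊕ κ) ⊕ τ → R) = 0 := by ext ((_ | _) | _) <;> rfl
  rw [this]

/-- The mapping cone: a linear resolution of `A + z B`, for `A ⊆ B` with linear resolutions, and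
`z` a form which is a nonzerodivisor modulo `A`. -/
theorem exists_cone (P : LinearResolution A (g + α) α) (Q : LinearResolution B g α)
    (hAB : A ≤ B) {z : MvPolynomial σ K} (hz : z.IsHomogeneous α) (hz0 : z ≠ 0)
    (hzA : ∀ f, z * f ∈ A → f ∈ A) :
    ∃ C : LinearResolution (A ⊔ Ideal.span {z} * B) (g + α) α, ∀ i, Fintype.card (C.ι i) =
      Fintype.card (P.ι i) + Fintype.card (Q.ι i) + Fintype.card (P.shiftIndex i) := by
  classical
  obtain ⟨φ, hφ, e₀, e⟩ := exists_lift P Q hAB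
  have e₀' : ∀ w, P.a *ᵥ w = Q.a *ᵥ (φ 0 *ᵥ w) := fun w => by rw [mulVec_mulVec, e₀]
  have e' : ∀ i w, φ i *ᵥ (P.d i *ᵥ w) = Q.d i *ᵥ (φ (i + 1) *ᵥ w) := fun i w => by
    rw [mulVec_mulVec, mulVec_mulVec, e]
  have hPa : ∀ y, P.a *ᵥ (P.d 0 *ᵥ y) = 0 := fun y => (P.exact_zero _).mpr ⟨y, rfl⟩
  have hQa : ∀ y, Q.a *ᵥ (Q.d 0 *ᵥ y) = 0 := fun y => (Q.exact_zero _).mpr ⟨y, rfl⟩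
  have hP : ∀ i y, P.d i *ᵥ (P.d (i + 1) *ᵥ y) = 0 := fun i y => (P.exact_succ _ _).mpr ⟨y, rfl⟩
  have hQ : ∀ i y, Q.d i *ᵥ (Q.d (i + 1) *ᵥ y) = 0 := fun i y => (Q.exact_succ _ _).mpr ⟨y, rfl⟩
  let a : Matrix Unit ((P.ι 0 ⊕ Q.ι 0) ⊕ P.shiftIndex 0) (MvPolynomial σ K) :=
    fun u => Sum.elim (Sum.elim (P.a u) (z • Q.a u)) (fun k => k.elim)
  have ha : ∀ x y w, a *ᵥ Sum.elim (Sum.elim x y) w = P.a *ᵥ x + z • (Q.a *ᵥ y) := by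
    intro x y w
    ext1 u
    have : ∀ k : P.shiftIndex 0, False := fun k => k.elim
    simp only [mulVec, dotProduct, a, Fintype.sum_sum_type, Sum.elim_inl, Sum.elim_inr,
      Pi.add_apply, Pi.smul_apply, smul_eq_mul, Finset.mul_sum, mul_assoc]
    rw [Finset.sum_eq_zero (s := (Finset.univ : Finset (P.shiftIndex 0)))
      (fun k _ => (this k).elim), add_zero]
  refine ⟨⟨fun i => (P.ι i ⊕ Q.ι i) ⊕ P.shiftIndex i, fun i => inferInstance, a,
    coneD P Q z φ, ?_, ?_, ?_, ?_, ?_⟩, fun i => by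
      simp only [Fintype.card_sum]⟩
  · rintro u ((j | j) | j)
    · exact P.a_hom u j
    · have := hz.mul (Q.a_hom u j)
      rwa [add_comm] at this
    · exact j.elim
  · rintro i ((k | k) | k) ((j | j) | j)
    · exact P.d_hom i k j
    · exact isHomogeneous_zero _ _ _
    · have key : ∀ j : P.ι i,
          (z * (1 : Matrix (P.ι i) (P.ι i) (MvPolynomial σ K)) k j).IsHomogeneous α := by
        intro j
        rw [Matrix.one_apply]
        split_ifs
        · rwa [mul_one]
        · rw [mul_zero]; exact isHomogeneous_zero _ _ _
      exact key j
    · exact isHomogeneous_zero _ _ _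
    · exact Q.d_hom i k j
    · exact (hφ i k j).neg
    · exact isHomogeneous_zero _ _ _
    · exact isHomogeneous_zero _ _ _
    · exact (P.shiftD_hom i k j).neg
  · intro f
    rw [Submodule.mem_sup]
    constructor
    · rintro ⟨p, hp, q, hq, rfl⟩
      obtain ⟨b, hb, rfl⟩ := Ideal.mem_span_singleton_mul.mp hq
      obtain ⟨x, hx⟩ := (P.mem_iff _).mp hp
      obtain ⟨y, hy⟩ := (Q.mem_iff _).mp hb
      refine ⟨Sum.elim (Sum.elim x y) (fun k => k.elim), ?_⟩
      rw [ha, hx, hy]; rfl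
    · rintro ⟨v, hv⟩
      obtain ⟨x, y, w, rfl⟩ := exists_sum_elim v
      rw [ha] at hv
      refine ⟨(P.a *ᵥ x) (), (P.mem_iff _).mpr ⟨x, rfl⟩, z * (Q.a *ᵥ y) (),
        Ideal.mem_span_singleton_mul.mpr ⟨_, (Q.mem_iff _).mpr ⟨y, rfl⟩, rfl⟩, ?_⟩
      exact congrFun hv ()
  · intro v
    obtain ⟨x, y, w, rfl⟩ := exists_sum_elim v
    rw [ha]
    constructor
    · intro h
      -- A relation a + zb = 0 puts zb, hence b, into A: the kernel of A ⊕ B → A + zB is a copy of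
      -- A, and w' represents -b in it.
      have hx : z * (-(Q.a *ᵥ y) ()) ∈ A := (P.mem_iff _).mpr ⟨x, by
        ext1 u
        have := congrFun h u
        simp only [Pi.add_apply, Pi.smul_apply, smul_eq_mul, Pi.zero_apply] at this
        linear_combination this⟩
      obtain ⟨w', hw'⟩ := (P.mem_iff _).mp (hzA _ hx)
      have hQy : Q.a *ᵥ y = -(P.a *ᵥ w') := by rw [hw']; ext1 u; simp
      obtain ⟨y', hy'⟩ := (Q.exact_zero (y + φ 0 *ᵥ w')).mp (by
        rw [mulVec_add, ← e₀', hQy, neg_add_cancel])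
      obtain ⟨x', hx'⟩ := (P.exact_zero (x - z • w')).mp (by
        rw [mulVec_sub, mulVec_smul, ← h, hQy, smul_neg]; abel)
      refine ⟨Sum.elim (Sum.elim x' y') (P.shiftVec w'), ?_⟩
      rw [coneD_mulVec, sum_elim_inj]
      exact ⟨by rw [hx']; abel, by rw [hy']; abel, by ext k; exact k.elim⟩
    · rintro ⟨v, hv⟩
      obtain ⟨x', y', w', rfl⟩ := exists_sum_elim v
      obtain ⟨w', rfl⟩ := P.shiftVec_surjective w'
      rw [coneD_mulVec, sum_elim_inj] at hv
      rw [← hv.1, ← hv.2.1, mulVec_add, mulVec_sub, hPa, hQa, mulVec_smul, ← e₀', smul_sub]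
      simp
  · intro i v
    obtain ⟨x, y, w, rfl⟩ := exists_sum_elim v
    obtain ⟨w, rfl⟩ := P.shiftVec_surjective w
    rw [coneD_mulVec, sum_elim_eq_zero]
    constructor
    · rintro ⟨hx, hy, hw⟩
      -- For i = 0 the shifted differential has an empty target and carries no information. Instead,
      -- applying the augmentation of P to the first component gives z times the image of w, which
      -- vanishes only if that image does.
      have hw' : ∃ w', P.d i *ᵥ w' = w := by
        rcases i with _ | i
        · refine (P.exact_zero w).mp ?_
          have := congrArg (P.a *ᵥ ·) hx
          simp only [mulVec_add, mulVec_smul, hPa, zero_add, mulVec_zero] at this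
          exact (smul_eq_zero.mp this).resolve_left hz0
        · rw [neg_eq_zero, shiftD_succ_mulVec, shiftVec_eq_zero] at hw
          exact (P.exact_succ i w).mp hw
      obtain ⟨w', rfl⟩ := hw'
      obtain ⟨x', hx'⟩ := (P.exact_succ i (x + z • w')).mp (by
        rw [mulVec_add, mulVec_smul, hx])
      obtain ⟨y', hy'⟩ := (Q.exact_succ i (y - φ (i + 1) *ᵥ w')).mp (by
        rw [mulVec_sub, ← e', hy])
      refine ⟨Sum.elim (Sum.elim x' y') (P.shiftVec (-w')), ?_⟩
      rw [coneD_mulVec, sum_elim_inj]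
      refine ⟨by rw [hx', smul_neg]; abel, by rw [hy', mulVec_neg]; abel, ?_⟩
      rw [shiftVec_neg, mulVec_neg, neg_neg, shiftD_succ_mulVec]
    · rintro ⟨v, hv⟩
      obtain ⟨x', y', w', rfl⟩ := exists_sum_elim v
      obtain ⟨w', rfl⟩ := P.shiftVec_surjective w'
      rw [coneD_mulVec, sum_elim_inj] at hv
      obtain ⟨h1, h2, h3⟩ := hv
      rw [shiftD_succ_mulVec, ← shiftVec_neg, shiftVec_inj] at h3
      refine ⟨?_, ?_, ?_⟩
      · rw [← h1, ← h3, mulVec_add, hP, mulVec_smul]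
        simp
      · rw [← h2, ← h3, mulVec_sub, hQ, ← e', mulVec_neg]
        simp
      · rw [← h3, shiftVec_neg, mulVec_neg, neg_neg, shiftD_mulVec_d]

end LinearResolution

end LinearResolutions

/-! ### The linear resolution of the dual ideal -/

section DualResolution

open Matrix

variable {K : Type*} [Field K] {σ : Type*}

namespace LinearResolution

/-- The resolution of the zero ideal. -/
noncomputable def ofBot (g α : ℕ) : LinearResolution (⊥ : Ideal (MvPolynomial σ K)) g α where
  ι _ := Empty
  fin _ := inferInstance
  a := 0
  d _ := 0
  a_hom _ j := j.elim
  d_hom _ k := k.elim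
  mem_iff f := by
    simp only [Ideal.mem_bot, zero_mulVec]
    exact ⟨fun h => ⟨0, by rw [h]; rfl⟩, fun ⟨_, h⟩ => (congrFun h ()).symm⟩
  exact_zero x := by simp [Subsingleton.elim x 0]
  exact_succ i x := by simp [Subsingleton.elim x 0]

/-- The index types of the resolution of the unit ideal. -/
def topIndex : ℕ → Type
  | 0 => Unit
  | _ + 1 => Empty

instance : ∀ i, Fintype (topIndex i)
  | 0 => inferInstanceAs (Fintype Unit)
  | _ + 1 => inferInstanceAs (Fintype Empty)

instance (i : ℕ) : IsEmpty (topIndex (i + 1)) := inferInstanceAs (IsEmpty Empty)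

theorem card_topIndex : ∀ i, Fintype.card (topIndex i) = if i = 0 then 1 else 0
  | 0 => rfl
  | _ + 1 => rfl

/-- The resolution of the unit ideal. -/
noncomputable def ofTop (α : ℕ) : LinearResolution (⊤ : Ideal (MvPolynomial σ K)) 0 α where
  ι := topIndex
  fin := inferInstance
  a := Matrix.of fun _ _ => 1
  d _ := 0
  a_hom _ _ := isHomogeneous_one _ _
  d_hom _ _ _ := isHomogeneous_zero _ _ _
  mem_iff f := by
    refine ⟨fun _ => ⟨fun _ => f, ?_⟩, fun _ => Submodule.mem_top⟩
    ext1 u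
    change ∑ j : Unit, 1 * f = f
    simp
  exact_zero x := by
    simp only [zero_mulVec]
    constructor
    · intro h
      refine ⟨0, ?_⟩
      ext1 u
      have h' : ∑ j : Unit, 1 * (show Unit → MvPolynomial σ K from x) j = 0 := congrFun h ()
      rw [Fintype.sum_unique, one_mul] at h'
      exact h'.symm
    · rintro ⟨y, rfl⟩
      rw [mulVec_zero]
  exact_succ i x := by simp [Subsingleton.elim x 0]

theorem card_shiftIndex {I : Ideal (MvPolynomial σ K)} {g α : ℕ} (P : LinearResolution I g α) :
    ∀ i, Fintype.card (P.shiftIndex i) = if i = 0 then 0 else Fintype.card (P.ι (i - 1))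
  | 0 => rfl
  | _ + 1 => rfl

end LinearResolution

/-- The Betti numbers of the ideals generated by the monomials of `dualExponents`. -/
def dualBetti : ℕ → ℕ → ℕ → ℕ
  | _, 0, i => if i = 0 then 1 else 0
  | 0, _ + 1, _ => 0
  | p + 1, c + 1, i => dualBetti p (c + 1) i + dualBetti (p + 1) c i +
      if i = 0 then 0 else dualBetti p (c + 1) (i - 1)

theorem dualBetti_zero_right (p i : ℕ) : dualBetti p 0 i = if i = 0 then 1 else 0 := by
  cases p <;> simp [dualBetti]

/-- Only the index-shifted summand reaches the new last position, so each colour lengthens the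
resolution by exactly one. When c = 0 the middle summand lives in position 0 only. -/
theorem dualBetti_pos_iff (p c i : ℕ) : 0 < dualBetti p (c + 1) i ↔ i < p := by
  induction p generalizing c i with
  | zero => simp [dualBetti]
  | succ p ihp =>
    induction c with
    | zero =>
      rw [dualBetti, dualBetti_zero_right]
      rcases i with _ | i
      · simp
      · have := ihp 0 (i + 1)
        have := ihp 0 i
        simp only [Nat.add_eq_zero_iff, one_ne_zero, and_false, if_false, add_zero,
          Nat.add_sub_cancel]
        omega
    | succ c ihc =>
      have h1 := ihp (c + 1) i
      have h2 := ihp (c + 1) (i - 1)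
      rw [dualBetti]
      split_ifs <;> omega

theorem dualBetti_one (c i : ℕ) : dualBetti 1 c i = if i = 0 then 1 else 0 := by
  induction c with
  | zero => exact dualBetti_zero_right _ _
  | succ c ih => simp [dualBetti, ih]

theorem dualBetti_two (c i : ℕ) :
    dualBetti 2 c i = if i = 0 then c + 1 else if i = 1 then c else 0 := by
  induction c with
  | zero => rw [dualBetti_zero_right]; split_ifs <;> rfl
  | succ c ih =>
    rw [dualBetti, dualBetti_one, dualBetti_one, ih]
    rcases i with _ | _ | i <;> simp
    omega

/-- Iterated mapping cones, by induction on the number of colours and then on c. The degree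
hypothesis is confined to k < n, a < N because blocks outside a diagram have smaller degree. -/
theorem exists_linearResolution_dualExponents {E : ℕ → ℕ → σ →₀ ℕ}
    (hE : ∀ k l a b, k ≠ l → Disjoint (E k a) (E l b)) {α n N : ℕ}
    (hd : ∀ k < n, ∀ a < N, (E k a).degree = α) (p : ℕ) (hp : p ≤ n) (c : ℕ) (hc : c ≤ N) :
    ∃ P : LinearResolution (monomialIdeal K (dualExponents E p c)) (c * α) α,
      ∀ i, Fintype.card (P.ι i) = dualBetti p c i := by
  induction p generalizing c with
  | zero =>
    rcases c with _ | c
    · rw [dualExponents_zero_right, monomialIdeal_singleton_zero, zero_mul]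
      exact ⟨.ofTop α, fun i => by
        rw [dualBetti_zero_right]; exact LinearResolution.card_topIndex i⟩
    · rw [dualExponents_zero_left, monomialIdeal_empty]
      exact ⟨.ofBot _ α, fun i => by
        rw [dualBetti]; exact Fintype.card_eq_zero (α := Empty)⟩
  | succ p ihp =>
    -- Splitting off the first block of the last colour moves the start of the run, so the inner
    -- induction must allow every shift s; the bound keeps all blocks inside the range where their
    -- degree is known.
    have key : ∀ s, c + s ≤ N →
        ∃ P : LinearResolution (monomialIdeal K (shiftedDualExponents E p c s)) (c * α) α,
          ∀ i, Fintype.card (P.ι i) = dualBetti (p + 1) c i := by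
      induction c with
      | zero =>
        intro s _
        rw [shiftedDualExponents_zero, monomialIdeal_singleton_zero, zero_mul]
        exact ⟨.ofTop α, fun i => by
          rw [dualBetti_zero_right]; exact LinearResolution.card_topIndex i⟩
      | succ c ihc =>
        intro s hs
        have hP := ihp (by omega) (c + 1) hc
        rw [show (c + 1) * α = c * α + α by ring] at hP ⊢
        obtain ⟨P, hP⟩ := hP
        obtain ⟨Q, hQ⟩ := ihc (by omega) (s + 1) (by omega)
        rw [shiftedDualExponents_succ, monomialIdeal_union, monomialIdeal_add_image]
        obtain ⟨C, hC⟩ := P.exists_cone Q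
          (monomialIdeal_mono fun m hm => by
            obtain ⟨d, hd, hdm⟩ := exists_le_of_mem_dualExponents_succ E hm
            exact ⟨d, dualExponents_subset_shifted E p c (s + 1) hd, hdm⟩)
          (z := monomial (E p s) 1)
          (isHomogeneous_monomial _ (hd p (by omega) s (by omega)))
          (monomial_eq_zero.not.mpr one_ne_zero)
          (fun f => mem_monomialIdeal_of_monomial_mul_mem fun m hm =>
            disjoint_of_mem_dualExponents E hE hm s)
        refine ⟨C, fun i => ?_⟩
        rw [hC, hP, hQ, LinearResolution.card_shiftIndex, hP, dualBetti]
    rw [dualExponents_succ]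
    exact key 0 (by omega)

end DualResolution

/-! ### Pure resolutions: reindexing and direct sums -/

section PureResolutions

open Matrix

variable {K : Type*} [Field K] {σ : Type*}
  {M : Type*} [AddCommGroup M] [Module K M] [Module (MvPolynomial σ K) M]

/-- Bases indexed by arbitrary finite types, such as the sums and products produced by cones and
direct sums, are transported along bijections with `Fin (β i)`. -/
theorem hasPureResolution_of_fintype {ℳ : ℕ → Submodule K M} {s : ℕ} {a β : ℕ → ℕ}
    {ι : ℕ → Type} [∀ i, Fintype (ι i)] [∀ i, DecidableEq (ι i)]
    (hβ : ∀ i, Fintype.card (ι i) = β i)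
    (ha : ∀ i < s, a i < a (i + 1)) (hpos : ∀ i, 0 < β i ↔ i ≤ s)
    (A : ∀ i, Matrix (ι i) (ι (i + 1)) (MvPolynomial σ K))
    (ε : (ι 0 → MvPolynomial σ K) →ₗ[MvPolynomial σ K] M)
    (hA : ∀ i k j, (A i k j).IsHomogeneous (a (i + 1) - a i))
    (hε : ∀ j, ε (Pi.single j 1) ∈ ℳ (a 0)) (hsurj : Function.Surjective ε)
    (h0 : Function.Exact (A 0).mulVecLin ε)
    (h1 : ∀ i, Function.Exact (A (i + 1)).mulVecLin (A i).mulVecLin) :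
    HasPureResolution σ ℳ s a β := by
  refine ⟨ha, hpos, ?_⟩
  have e : ∀ i, ι i ≃ Fin (β i) := fun i => Fintype.equivFinOfCardEq (hβ i)
  let L : ∀ i, (ι i → MvPolynomial σ K) ≃ₗ[MvPolynomial σ K] (Fin (β i) → MvPolynomial σ K) :=
    fun i => LinearEquiv.funCongrLeft _ _ (e i).symm
  let A' : ∀ i, Matrix (Fin (β i)) (Fin (β (i + 1))) (MvPolynomial σ K) :=
    fun i => (A i).submatrix (e i).symm (e (i + 1)).symm
  have hL : ∀ i x, (A' i).mulVecLin (L (i + 1) x) = L i ((A i).mulVecLin x) := by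
    intro i x
    ext1 k
    simp only [A', L, mulVecLin_apply, LinearEquiv.funCongrLeft_apply, LinearMap.funLeft_apply]
    rw [submatrix_mulVec_equiv]
    simp [Function.comp_def, LinearMap.funLeft_apply]
  refine ⟨A', ε ∘ₗ (L 0).symm.toLinearMap, fun i k j => hA i _ _, fun j => ?_,
    hsurj.comp (L 0).symm.surjective, ?_, fun i => ?_⟩
  · have : (L 0).symm (Pi.single j 1) = Pi.single ((e 0).symm j) 1 := by
      rw [LinearEquiv.symm_apply_eq]
      ext1 k
      simp only [L, LinearEquiv.funCongrLeft_apply, LinearMap.funLeft_apply, Pi.single_apply,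
        (e 0).symm.injective.eq_iff]
    rw [LinearMap.comp_apply]
    exact this ▸ hε _
  · intro x
    obtain ⟨x, rfl⟩ := (L 0).surjective x
    simp only [LinearMap.comp_apply, LinearEquiv.coe_coe, LinearEquiv.symm_apply_apply]
    rw [h0 x]
    constructor
    · rintro ⟨y, rfl⟩
      exact ⟨L 1 y, hL 0 y⟩
    · rintro ⟨y, hy⟩
      obtain ⟨y, rfl⟩ := (L 1).surjective y
      exact ⟨y, (L 0).injective ((hL 0 y).symm.trans hy)⟩
  · intro x
    obtain ⟨x, rfl⟩ := (L (i + 1)).surjective x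
    rw [hL, LinearEquiv.map_eq_zero_iff, h1 i x]
    constructor
    · rintro ⟨y, rfl⟩
      exact ⟨L (i + 1 + 1) y, hL _ y⟩
    · rintro ⟨y, hy⟩
      obtain ⟨y, rfl⟩ := (L (i + 1 + 1)).surjective y
      exact ⟨y, (L (i + 1)).injective ((hL _ y).symm.trans hy)⟩

/-- The direct sum of `b` copies of a module with a pure resolution has a pure resolution. -/
theorem HasPureResolution.copies {I : Ideal (MvPolynomial σ K)} {s : ℕ} {a β : ℕ → ℕ}
    (h : HasPureResolution σ (quotientGrading I) s a β) {b : ℕ} (hb : 0 < b) :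
    HasPureResolution σ (copiesGrading I b) s a (fun i => b * β i) := by
  classical
  obtain ⟨ha, hpos, A, ε, hA, hε, hsurj, h0, h1⟩ := h
  have hmul : ∀ i (x : Fin (β (i + 1)) × Fin b → MvPolynomial σ K) k l,
      (blockDiagonal (fun _ : Fin b => A i) *ᵥ x) (k, l) = (A i *ᵥ fun j => x (j, l)) k := by
    intro i x k l
    simp only [mulVec, dotProduct, Fintype.sum_prod_type, blockDiagonal_apply, ite_mul, zero_mul,
      Finset.sum_ite_eq, Finset.mem_univ, if_true]
  let ε' : (Fin (β 0) × Fin b → MvPolynomial σ K) →ₗ[MvPolynomial σ K]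
      (Fin b → MvPolynomial σ K ⧸ I) :=
    LinearMap.pi fun l => ε ∘ₗ LinearMap.funLeft _ _ fun k => (k, l)
  have hε' : ∀ x l, ε' x l = ε fun k => x (k, l) := fun x l => rfl
  refine hasPureResolution_of_fintype (ι := fun i => Fin (β i) × Fin b)
    (fun i => by simp [mul_comm]) ha (fun i => by rw [← hpos i, Nat.mul_pos_iff_of_pos_left hb])
    (fun i => blockDiagonal fun _ => A i) ε' ?_ ?_ ?_ ?_ ?_
  · rintro i ⟨k, l⟩ ⟨j, l'⟩
    rw [blockDiagonal_apply]
    split_ifs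
    · exact hA i k j
    · exact isHomogeneous_zero _ _ _
  · rintro ⟨j, l⟩
    rw [copiesGrading, Submodule.mem_pi]
    rintro l' -
    rw [hε']
    by_cases h : l' = l
    · subst h
      convert hε j using 2
      ext1 k
      simp [Pi.single_apply]
    · have : (fun k => (Pi.single (j, l) 1 : Fin (β 0) × Fin b → MvPolynomial σ K)
          (k, l')) = 0 := by
        ext1 k
        simp [h]
      have h0 := (congrArg ε this).trans (map_zero ε)
      exact (congrArg (· ∈ quotientGrading I (a 0)) h0).mpr (Submodule.zero_mem _)
  · intro y
    choose x hx using fun l => hsurj (y l)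
    exact ⟨fun kl => x kl.2 kl.1, funext fun l => hx l⟩
  · intro x
    constructor
    · intro hx
      have : ∀ l, ∃ y, (A 0).mulVecLin y = fun k => x (k, l) := fun l => (h0 _).mp (congrFun hx l)
      choose y hy using this
      exact ⟨fun jl => y jl.2 jl.1, funext fun kl => (hmul 0 _ kl.1 kl.2).trans
        (congrFun (hy kl.2) kl.1)⟩
    · rintro ⟨y, rfl⟩
      ext1 l
      refine (h0 _).mpr ⟨fun j => y (j, l), ?_⟩
      ext1 k
      exact (hmul 0 y k l).symm
  · intro i x
    constructor
    · intro hx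
      have : ∀ l, ∃ y, (A (i + 1)).mulVecLin y = fun k => x (k, l) := by
        intro l
        refine (h1 i _).mp ?_
        ext1 k
        have := congrFun hx (k, l)
        rw [mulVecLin_apply, hmul] at this
        exact this
      choose y hy using this
      refine ⟨fun jl => y jl.2 jl.1, ?_⟩
      ext1 kl
      rw [mulVecLin_apply, hmul]
      exact congrFun (hy kl.2) kl.1
    · rintro ⟨y, rfl⟩
      ext1 kl
      rw [mulVecLin_apply, mulVecLin_apply, hmul]
      have : (fun j => (blockDiagonal (fun _ : Fin b => A (i + 1)) *ᵥ y) (j, kl.2)) =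
          (A (i + 1)).mulVecLin fun j => y (j, kl.2) := by
        ext1 j
        rw [hmul, mulVecLin_apply]
      rw [this]
      exact congrFun ((h1 i).apply_apply_eq_zero _) kl.1

end PureResolutions

/-! ### Regular sequences on quotients by ideals -/

section IdealRegular

variable {R : Type*} [CommRing R]

/-- The sequence `rs` is weakly regular on `R ⧸ I`, in terms of ideals of `R`. -/
def IdealRegular (I : Ideal R) : List R → Prop
  | [] => True
  | r :: rs => (∀ f, r * f ∈ I → f ∈ I) ∧ IdealRegular (I ⊔ Ideal.span {r}) rs

open Pointwise in
-- Induction through the isomorphism of (R/I)/r(R/I) with R/(I + (r)).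
theorem IdealRegular.isWeaklyRegular {rs : List R} {I : Ideal R} (h : IdealRegular I rs) :
    RingTheory.Sequence.IsWeaklyRegular (R ⧸ I) rs := by
  induction rs generalizing I with
  | nil => exact RingTheory.Sequence.IsWeaklyRegular.nil _ _
  | cons r rs ih =>
    obtain ⟨h1, h2⟩ := h
    refine RingTheory.Sequence.IsWeaklyRegular.cons ?_ ?_
    · rw [isSMulRegular_iff_right_eq_zero_of_smul]
      intro x hx
      obtain ⟨f, rfl⟩ := Ideal.Quotient.mk_surjective x
      rw [← Ideal.Quotient.mk_eq_mk, ← Submodule.Quotient.mk_smul, Ideal.Quotient.mk_eq_mk,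
        Ideal.Quotient.eq_zero_iff_mem] at hx
      exact Ideal.Quotient.eq_zero_iff_mem.mpr (h1 f hx)
    · have e1 : r • (⊤ : Submodule R (R ⧸ I)) =
          Submodule.map (Submodule.mkQ I) (Ideal.span {r}) := by
        rw [← Ideal.submodule_span_eq, Submodule.map_span, Set.image_singleton]
        ext x
        rw [Submodule.mem_smul_pointwise_iff_exists, Submodule.mem_span_singleton]
        constructor
        · rintro ⟨y, -, rfl⟩
          obtain ⟨f, rfl⟩ := Ideal.Quotient.mk_surjective y
          exact ⟨f, by
            rw [Submodule.mkQ_apply, ← Submodule.Quotient.mk_smul, ← Ideal.Quotient.mk_eq_mk,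
              ← Submodule.Quotient.mk_smul, smul_eq_mul, smul_eq_mul, mul_comm]⟩
        · rintro ⟨f, rfl⟩
          exact ⟨Ideal.Quotient.mk I f, trivial, by
            rw [Submodule.mkQ_apply, ← Submodule.Quotient.mk_smul, ← Ideal.Quotient.mk_eq_mk,
              ← Submodule.Quotient.mk_smul, smul_eq_mul, smul_eq_mul, mul_comm]⟩
      have e := (Submodule.quotEquivOfEq _ _ e1).trans
        (Submodule.quotientQuotientEquivQuotientSup I (Ideal.span {r}))
      exact (LinearEquiv.isWeaklyRegular_congr e rs).mpr (ih h2)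

/-- Weak regularity admits the zero module, so branches where the ideal becomes the unit ideal are
harmless. -/
theorem idealRegular_top (rs : List R) : IdealRegular (⊤ : Ideal R) rs := by
  induction rs with
  | nil => trivial
  | cons r rs ih => exact ⟨fun _ _ => trivial, by rwa [top_sup_eq]⟩

/-- A sequence which is regular on the outer terms of
`0 → R ⧸ (I : z) → R ⧸ I → R ⧸ (I + (z)) → 0` is regular on the middle one. -/
theorem IdealRegular.of_colon {rs : List R} {I J : Ideal R} {z : R}
    (hJ : ∀ f, z * f ∈ I ↔ f ∈ J) (h1 : IdealRegular J rs)
    (h2 : IdealRegular (I ⊔ Ideal.span {z}) rs) : IdealRegular I rs := by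
  induction rs generalizing I J with
  | nil => trivial
  | cons r rs ih =>
    refine ⟨fun f hf => ?_, ih (J := J ⊔ Ideal.span {r}) (fun f => ?_) h1.2 ?_⟩
    -- Regularity on the right term gives f = i + gz with i in I; regularity on the left term then
    -- handles g.
    · have hf2 := h2.1 f (Ideal.mem_sup_left hf)
      obtain ⟨i, hi, y, hy, rfl⟩ := Submodule.mem_sup.mp hf2
      obtain ⟨g, rfl⟩ := Ideal.mem_span_singleton'.mp hy
      refine I.add_mem hi ?_
      rw [mul_comm, hJ]
      refine h1.1 g ((hJ _).mp ?_)
      have : z * (r * g) = r * (i + g * z) - r * i := by ring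
      rw [this]
      exact I.sub_mem hf (I.mul_mem_left _ hi)
    -- The colon relation persists after adding r. If zf = i + hr, then h lies in I + (z) by
    -- regularity of r there; subtracting the multiple of r so obtained brings f into J.
    · constructor
      · intro hf
        obtain ⟨i, hi, y, hy, e⟩ := Submodule.mem_sup.mp hf
        obtain ⟨h, rfl⟩ := Ideal.mem_span_singleton'.mp hy
        have hh : h ∈ I ⊔ Ideal.span {z} := by
          refine h2.1 h ?_
          have : r * h = z * f - i := by linear_combination e
          rw [this]
          exact sub_mem (Ideal.mem_sup_right (Ideal.mem_span_singleton'.mpr ⟨f, mul_comm _ _⟩))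
            (Ideal.mem_sup_left hi)
        obtain ⟨i', hi', y', hy', rfl⟩ := Submodule.mem_sup.mp hh
        obtain ⟨h', rfl⟩ := Ideal.mem_span_singleton'.mp hy'
        refine Submodule.mem_sup.mpr ⟨f - r * h', (hJ _).mp ?_, r * h',
          Ideal.mem_span_singleton'.mpr ⟨h', mul_comm _ _⟩, by ring⟩
        have : z * (f - r * h') = i + r * i' := by linear_combination -e
        rw [this]
        exact I.add_mem hi (I.mul_mem_left _ hi')
      · intro hf
        obtain ⟨j, hj, y, hy, rfl⟩ := Submodule.mem_sup.mp hf
        obtain ⟨h, rfl⟩ := Ideal.mem_span_singleton'.mp hy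
        rw [mul_add]
        exact add_mem (Ideal.mem_sup_left ((hJ _).mpr hj))
          (Ideal.mem_sup_right (Ideal.mem_span_singleton'.mpr ⟨z * h, by ring⟩))
    · rw [sup_right_comm]
      exact h2.2

theorem IdealRegular.cons_of_sub_mem {I : Ideal R} {r r' : R} {rs : List R} (h : r - r' ∈ I)
    (hr : IdealRegular I (r' :: rs)) : IdealRegular I (r :: rs) := by
  have e : I ⊔ Ideal.span {r} = I ⊔ Ideal.span {r'} := by
    refine le_antisymm (sup_le le_sup_left ?_) (sup_le le_sup_left ?_) <;>
      rw [Ideal.span_singleton_le_iff_mem]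
    · rw [← sub_add_cancel r r']
      exact add_mem (Ideal.mem_sup_left h) (Ideal.mem_sup_right (Ideal.mem_span_singleton_self _))
    · rw [← sub_sub_cancel r r']
      exact sub_mem (Ideal.mem_sup_right (Ideal.mem_span_singleton_self _)) (Ideal.mem_sup_left h)
  refine ⟨fun f hf => hr.1 f ?_, e ▸ hr.2⟩
  have : r' * f = r * f - (r - r') * f := by ring
  rw [this]
  exact I.sub_mem hf (I.mul_mem_right _ h)

theorem sup_sup_mul_sup (X A B S : Ideal R) : X ⊔ (S * A ⊔ B) ⊔ S = X ⊔ S ⊔ B := by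
  have h : S * A ≤ S := Ideal.mul_le_left
  rw [sup_assoc, sup_right_comm (S * A), sup_eq_right.mpr h, sup_assoc]

end IdealRegular

/-! ### Elementary symmetric polynomials as a regular sequence -/

section ElementarySymmetric

variable {K : Type*} [Field K] {σ : Type*}

theorem mem_span_X_of_prod_X_mul_mem {Z T : Finset σ} (h : Disjoint Z T) {f : MvPolynomial σ K}
    (hf : (∏ v ∈ T, X v) * f ∈ Ideal.span (X '' (Z : Set σ) : Set (MvPolynomial σ K))) :
    f ∈ Ideal.span (X '' (Z : Set σ) : Set (MvPolynomial σ K)) := by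
  classical
  induction T using Finset.induction_on with
  | empty => simpa using hf
  | insert v T hv ih =>
    rw [Finset.disjoint_insert_right] at h
    refine ih h.2 ?_
    rw [Finset.prod_insert hv, mul_assoc, span_X_image] at hf
    rw [span_X_image]
    refine mem_monomialIdeal_of_monomial_mul_mem (e := Finsupp.single v 1) ?_ hf
    rintro _ ⟨u, hu, rfl⟩
    rw [Finsupp.disjoint_iff, Finsupp.support_single _ one_ne_zero,
      Finsupp.support_single _ one_ne_zero, Finset.disjoint_singleton]
    rintro rfl
    exact h.1 hu

theorem span_X_insert [DecidableEq σ] (v : σ) (Z : Finset σ) :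
    Ideal.span (X '' (insert v Z : Finset σ) : Set (MvPolynomial σ K)) =
      Ideal.span (X '' (Z : Set σ)) ⊔ Ideal.span {X v} := by
  rw [Finset.coe_insert, Set.image_insert_eq, Set.insert_eq, Ideal.span_union, sup_comm]

theorem disjoint_of_mem_simplexExponents {E : ℕ → ℕ → σ →₀ ℕ} {p c : ℕ} {m f : σ →₀ ℕ}
    (hE : ∀ k < p, ∀ a, Disjoint (E k a) f) (hm : m ∈ simplexExponents E p c) : Disjoint m f := by
  classical
  obtain ⟨i, -, rfl⟩ := hm
  rw [Finsupp.disjoint_iff, Finset.disjoint_left]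
  intro v hv hv'
  obtain ⟨k, -, hk⟩ := Finset.mem_biUnion.mp (Finsupp.support_finsetSum hv)
  exact Finset.disjoint_left.mp (Finsupp.disjoint_iff.mp (hE k k.2 (i k))) hk hv'

theorem disjoint_of_mem_shiftedSimplexExponents {E : ℕ → ℕ → σ →₀ ℕ} {p c s : ℕ} {m f : σ →₀ ℕ}
    (hE : ∀ k < p, ∀ a, Disjoint (E k a) f) (hEp : ∀ a, s ≤ a → Disjoint (E p a) f)
    (hm : m ∈ shiftedSimplexExponents E p c s) : Disjoint m f := by
  classical
  obtain ⟨a, -, e, he, rfl⟩ := hm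
  have h1 := Finsupp.disjoint_iff.mp (hEp (a + s) (by omega))
  have h2 := Finsupp.disjoint_iff.mp (disjoint_of_mem_simplexExponents hE he)
  rw [Finsupp.disjoint_iff]
  exact (Finset.disjoint_union_left.mpr ⟨h1, h2⟩).mono_left Finsupp.support_add

variable [Fintype σ]

variable (K σ) in
/-- The elementary symmetric polynomials of degrees `D, D - 1, …, 1`. -/
noncomputable def esymmList : ℕ → List (MvPolynomial σ K)
  | 0 => []
  | D + 1 => esymm σ K (D + 1) :: esymmList D

theorem length_esymmList (D : ℕ) : (esymmList K σ D).length = D := by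
  induction D with
  | zero => rfl
  | succ D ih => rw [esymmList, List.length_cons, ih]

theorem mem_span_X_of_mem_esymmList {D : ℕ} {r : MvPolynomial σ K} (hr : r ∈ esymmList K σ D) :
    r ∈ Ideal.span (Set.range (X : σ → MvPolynomial σ K)) := by
  induction D with
  | zero => simp [esymmList] at hr
  | succ D ih =>
    rw [esymmList, List.mem_cons] at hr
    rcases hr with rfl | hr
    · rw [esymm]
      refine Ideal.sum_mem _ fun t ht => ?_
      have hc := (Finset.mem_powersetCard.mp ht).2
      obtain ⟨v, hv⟩ := Finset.card_pos.mp (by omega : 0 < t.card)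
      exact Ideal.mem_of_dvd _ (Finset.dvd_prod_of_mem _ hv) (Ideal.subset_span ⟨v, rfl⟩)
    · exact ih hr

/-- Every set of D variables other than the complement of Z meets Z. Hence the top elementary
symmetric polynomial becomes a monomial modulo Z, which is why the sequence runs through decreasing
degrees. -/
theorem esymm_sub_prod_mem [DecidableEq σ] {D : ℕ} {Z : Finset σ}
    (h : Z.card + D = Fintype.card σ) :
    esymm σ K D - ∏ v ∈ Zᶜ, X v ∈ Ideal.span (X '' (Z : Set σ) : Set (MvPolynomial σ K)) := by
  have hZ : Zᶜ.card = D := by rw [Finset.card_compl]; omega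
  rw [esymm, ← Finset.add_sum_erase _ _ (Finset.mem_powersetCard.mpr ⟨Finset.subset_univ Zᶜ, hZ⟩),
    add_sub_cancel_left]
  refine Ideal.sum_mem _ fun t ht => ?_
  obtain ⟨hne, ht⟩ := Finset.mem_erase.mp ht
  have hc := (Finset.mem_powersetCard.mp ht).2
  obtain ⟨v, hv, hv'⟩ : ∃ v ∈ t, v ∉ Zᶜ := by
    by_contra! hcon
    exact hne (Finset.eq_of_subset_of_card_le hcon (by omega))
  exact Ideal.mem_of_dvd _ (Finset.dvd_prod_of_mem _ hv)
    (Ideal.subset_span ⟨v, by simpa using hv', rfl⟩)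

/-- The elementary symmetric polynomials form a regular sequence on a quotient by variables. -/
theorem idealRegular_span_X {D : ℕ} {Z : Finset σ} (h : Z.card + D = Fintype.card σ) :
    IdealRegular (Ideal.span (X '' (Z : Set σ) : Set (MvPolynomial σ K))) (esymmList K σ D) := by
  classical
  induction D generalizing Z with
  | zero => trivial
  | succ D ih =>
    refine IdealRegular.cons_of_sub_mem (esymm_sub_prod_mem h)
      ⟨fun f hf => mem_span_X_of_prod_X_mul_mem disjoint_compl_right hf, ?_⟩
    -- The factors of the monomial are peeled off one at a time: the colon by x_v deletes v from T,
    -- while adding x_v moves v into Z, where the induction on D applies.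
    have key : ∀ T : Finset σ, Disjoint Z T →
        IdealRegular (Ideal.span (X '' (Z : Set σ) : Set (MvPolynomial σ K)) ⊔
          Ideal.span {∏ v ∈ T, X v}) (esymmList K σ D) := by
      intro T
      induction T using Finset.induction_on with
      | empty =>
        intro _
        rw [Finset.prod_empty, Ideal.span_singleton_one, sup_top_eq]
        exact idealRegular_top _
      | insert v T hv ihT =>
        intro hT
        rw [Finset.disjoint_insert_right] at hT
        refine IdealRegular.of_colon (z := X v) (fun f => ?_) (ihT hT.2) ?_
        · rw [Finset.prod_insert hv]
          constructor
          · intro hf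
            obtain ⟨x, hx, y, hy, e⟩ := Submodule.mem_sup.mp hf
            obtain ⟨g, rfl⟩ := Ideal.mem_span_singleton'.mp hy
            refine Submodule.mem_sup.mpr ⟨f - g * ∏ v ∈ T, X v, ?_, g * ∏ v ∈ T, X v,
              Ideal.mem_span_singleton'.mpr ⟨g, rfl⟩, by ring⟩
            refine mem_span_X_of_prod_X_mul_mem (T := {v}) (by simpa using hT.1) ?_
            rw [Finset.prod_singleton]
            convert hx using 1
            linear_combination -e
          · intro hf
            obtain ⟨x, hx, y, hy, rfl⟩ := Submodule.mem_sup.mp hf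
            obtain ⟨g, rfl⟩ := Ideal.mem_span_singleton'.mp hy
            rw [mul_add]
            exact add_mem (Ideal.mem_sup_left (Ideal.mul_mem_left _ _ hx))
              (Ideal.mem_sup_right (Ideal.mem_span_singleton'.mpr ⟨g, by ring⟩))
        · have : Ideal.span (X '' (Z : Set σ) : Set (MvPolynomial σ K)) ⊔
              Ideal.span {∏ v ∈ insert v T, X v} ⊔ Ideal.span {X v} =
              Ideal.span (X '' (insert v Z : Finset σ)) := by
            rw [span_X_insert, sup_assoc]
            congr 1
            rw [sup_eq_right, Ideal.span_singleton_le_span_singleton]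
            exact Finset.dvd_prod_of_mem _ (Finset.mem_insert_self _ _)
          rw [this]
          exact ih (by rw [Finset.card_insert_of_notMem hT.1]; omega)
    exact key _ disjoint_compl_right

/-- The elementary symmetric polynomials form a regular sequence on the quotient by the Ferrers
ideal of a simplex and by further variables. -/
theorem idealRegular_simplexExponents {E : ℕ → ℕ → σ →₀ ℕ}
    (hE : ∀ k l a b, (k, a) ≠ (l, b) → Disjoint (E k a) (E l b)) {n N : ℕ}
    (hv : ∀ k < n, ∀ a < N, ∃ v, E k a = Finsupp.single v 1) (p : ℕ) (hp : p ≤ n) (c : ℕ)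
    (hc : c ≤ N) {D : ℕ} {Z : Finset σ} (hZ : ∀ v ∈ Z, ∀ k < p, ∀ a, E k a v = 0)
    (h : Z.card + c + D = Fintype.card σ) :
    IdealRegular (Ideal.span (X '' (Z : Set σ) : Set (MvPolynomial σ K)) ⊔
      monomialIdeal K (simplexExponents E p c)) (esymmList K σ D) := by
  classical
  induction p generalizing c Z with
  | zero =>
    rcases c with _ | c
    · rw [simplexExponents_zero_right, monomialIdeal_empty, sup_bot_eq]
      exact idealRegular_span_X (by omega)
    · rw [simplexExponents_zero_left, monomialIdeal_singleton_zero, sup_top_eq]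
      exact idealRegular_top _
  | succ p ihp =>
    -- Adding z to the ideal puts its variable into Z, lowers c by one and raises the shift s. The
    -- sum of |Z| and c is preserved, so the same sequence works on both outer terms.
    have key : ∀ s (Z : Finset σ), c + s ≤ N → (∀ v ∈ Z, ∀ k < p, ∀ a, E k a v = 0) →
        (∀ v ∈ Z, ∀ a, s ≤ a → E p a v = 0) → Z.card + c + D = Fintype.card σ →
        IdealRegular (Ideal.span (X '' (Z : Set σ) : Set (MvPolynomial σ K)) ⊔
          monomialIdeal K (shiftedSimplexExponents E p c s)) (esymmList K σ D) := by
      clear hZ h Z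
      induction c with
      | zero =>
        intro s Z _ _ _ h
        rw [shiftedSimplexExponents_zero, monomialIdeal_empty, sup_bot_eq]
        exact idealRegular_span_X (by omega)
      | succ c ihc =>
        intro s Z hs hZ hZp h
        obtain ⟨v, hvs⟩ := hv p (by omega) s (by omega)
        have hvZ : v ∉ Z := fun hvZ => by
          have := hZp v hvZ s le_rfl
          simp [hvs] at this
        have hz : (monomial (E p s) 1 : MvPolynomial σ K) = X v := by rw [hvs]; rfl
        have hnz : ∀ f : MvPolynomial σ K, X v * f ∈ Ideal.span (X '' (Z : Set σ)) ⊔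
            monomialIdeal K (shiftedSimplexExponents E p c (s + 1)) →
            f ∈ Ideal.span (X '' (Z : Set σ)) ⊔
            monomialIdeal K (shiftedSimplexExponents E p c (s + 1)) := by
          intro f hf
          rw [← hz, span_X_image, ← monomialIdeal_union] at hf
          rw [span_X_image, ← monomialIdeal_union]
          refine mem_monomialIdeal_of_monomial_mul_mem ?_ hf
          rintro m (⟨u, hu, rfl⟩ | hm)
          · rw [hvs, Finsupp.disjoint_iff, Finsupp.support_single _ one_ne_zero,
              Finsupp.support_single _ one_ne_zero, Finset.disjoint_singleton]
            rintro rfl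
            exact hvZ hu
          · refine disjoint_of_mem_shiftedSimplexExponents (fun k hk a => hE _ _ _ _ ?_)
              (fun a ha => hE _ _ _ _ ?_) hm
            · rintro ⟨⟩; omega
            · rintro ⟨⟩; omega
        -- Dropping the variable of the last colour from a generator of B leaves a multiple of a
        -- generator of A.
        have hBA : monomialIdeal K (shiftedSimplexExponents E p c (s + 1)) ≤
            monomialIdeal K (simplexExponents E p (c + 1)) := by
          refine monomialIdeal_mono ?_
          rintro m ⟨a, ha, e, he, rfl⟩
          exact ⟨e, simplexExponents_mono E p (by omega) he, le_add_of_nonneg_left zero_le⟩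
        rw [shiftedSimplexExponents_succ, monomialIdeal_union, monomialIdeal_add_image, hz]
        refine IdealRegular.of_colon (z := X v) (J := Ideal.span (X '' (Z : Set σ)) ⊔
          monomialIdeal K (simplexExponents E p (c + 1))) (fun f => ?_)
          (ihp (by omega) (c + 1) hc hZ h) ?_
        · constructor
          · intro hf
            obtain ⟨x, hx, y, hy, e⟩ := Submodule.mem_sup.mp hf
            obtain ⟨y', hy', b, hb, rfl⟩ := Submodule.mem_sup.mp hy
            obtain ⟨a, ha, rfl⟩ := Ideal.mem_span_singleton_mul.mp hy'
            have h1 : f - a ∈ Ideal.span (X '' (Z : Set σ)) ⊔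
                monomialIdeal K (shiftedSimplexExponents E p c (s + 1)) := by
              refine hnz _ (Submodule.mem_sup.mpr ⟨x, hx, b, hb, ?_⟩)
              linear_combination e
            rw [← sub_add_cancel f a]
            exact add_mem (sup_le_sup_left hBA _ h1) (Ideal.mem_sup_right ha)
          · intro hf
            obtain ⟨x, hx, a, ha, rfl⟩ := Submodule.mem_sup.mp hf
            rw [mul_add]
            exact add_mem (Ideal.mem_sup_left (Ideal.mul_mem_left _ _ hx))
              (Ideal.mem_sup_right (Ideal.mem_sup_left
                (Ideal.mem_span_singleton_mul.mpr ⟨a, ha, rfl⟩)))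
        · have e : Ideal.span (X '' (Z : Set σ) : Set (MvPolynomial σ K)) ⊔
              (Ideal.span {X v} * monomialIdeal K (simplexExponents E p (c + 1)) ⊔
                monomialIdeal K (shiftedSimplexExponents E p c (s + 1))) ⊔ Ideal.span {X v} =
              Ideal.span (X '' (insert v Z : Finset σ)) ⊔
                monomialIdeal K (shiftedSimplexExponents E p c (s + 1)) := by
            rw [span_X_insert, sup_sup_mul_sup]
          rw [e]
          have hdis : ∀ k a, (k, a) ≠ (p, s) → E k a v = 0 := by
            intro k a hka
            have := Finsupp.disjoint_iff.mp (hE k p a s hka)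
            rw [hvs, Finsupp.support_single _ one_ne_zero, Finset.disjoint_singleton_right] at this
            exact Finsupp.notMem_support_iff.mp this
          refine ihc (by omega) (s + 1) (insert v Z) (by omega) ?_ ?_ ?_
          · intro u hu k hk a
            rcases Finset.mem_insert.mp hu with rfl | hu
            · exact hdis k a (by rintro ⟨⟩; omega)
            · exact hZ u hu k hk a
          · intro u hu a ha
            rcases Finset.mem_insert.mp hu with rfl | hu
            · exact hdis p a (by rintro ⟨⟩; omega)
            · exact hZp u hu a (by omega)
          · rw [Finset.card_insert_of_notMem hvZ]; omega
    rw [simplexExponents_succ]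
    exact key 0 Z (by omega) (fun v hv k hk => hZ v hv k (by omega))
      (fun v hv a _ => hZ v hv p (by omega) a) h

end ElementarySymmetric

/-! ### Dimension bounds from sets of variables -/

section KrullDimension

variable {K : Type*} [Field K] {σ : Type*} [Finite σ]

/-- Setting the variables of Z to zero maps S/I onto a polynomial ring in the remaining variables.
-/
theorem natCard_le_ringKrullDim_quotient_add {I : Ideal (MvPolynomial σ K)} {Z : Finset σ}
    (h : I ≤ Ideal.span (X '' (Z : Set σ))) :
    (Nat.card σ : WithBot ℕ∞) ≤ ringKrullDim (MvPolynomial σ K ⧸ I) + Z.card := by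
  classical
  let f : MvPolynomial σ K →ₐ[K] MvPolynomial {v // v ∉ Z} K :=
    aeval fun v => if h : v ∈ Z then 0 else X ⟨v, h⟩
  have hf : ∀ a ∈ I, f a = 0 := by
    intro a ha
    have : Ideal.span (X '' (Z : Set σ)) ≤ RingHom.ker f.toRingHom := by
      rw [Ideal.span_le]
      rintro _ ⟨v, hv, rfl⟩
      change f (X v) = 0
      have hv' : v ∈ Z := hv
      simp [f, hv']
    exact this (h ha)
  have hsurj : Function.Surjective (Ideal.Quotient.lift I f.toRingHom hf) := by
    refine Ideal.Quotient.lift_surjective_of_surjective _ _ fun g => ⟨rename Subtype.val g, ?_⟩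
    change f (rename Subtype.val g) = g
    rw [aeval_rename]
    convert aeval_X_left_apply g using 2
    ext v
    simp [v.2]
  have hdim := ringKrullDim_le_of_surjective _ hsurj
  rw [MvPolynomial.ringKrullDim_of_isNoetherianRing, ringKrullDim_eq_zero_of_field, zero_add]
    at hdim
  have hcard : Nat.card σ = Nat.card {v // v ∉ Z} + Z.card := by
    have := Fintype.ofFinite σ
    rw [Nat.card_eq_fintype_card, Nat.card_eq_fintype_card, Fintype.card_subtype_compl,
      Fintype.card_coe, Nat.sub_add_cancel (Finset.card_le_univ Z)]
  rw [hcard, Nat.cast_add]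
  gcongr

theorem ringKrullDim_quotient_span_X_add_le (Z : Finset σ) :
    ringKrullDim (MvPolynomial σ K ⧸ Ideal.span (X '' (Z : Set σ) : Set (MvPolynomial σ K))) +
      Z.card ≤ Nat.card σ := by
  classical
  let I : Ideal (MvPolynomial σ K) := Ideal.span (X '' (Z : Set σ))
  let f : MvPolynomial {v // v ∉ Z} K →ₐ[K] MvPolynomial σ K ⧸ I :=
    (Ideal.Quotient.mkₐ K I).comp (rename Subtype.val)
  let g : MvPolynomial σ K →ₐ[K] MvPolynomial {v // v ∉ Z} K :=
    aeval fun v => if h : v ∈ Z then 0 else X ⟨v, h⟩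
  have hfg : f.comp g = Ideal.Quotient.mkₐ K I := by
    ext v
    by_cases h : v ∈ Z
    · simp only [g, AlgHom.comp_apply, aeval_X, h, dif_pos, map_zero]
      have hv : (X v : MvPolynomial σ K) ∈ I := Ideal.subset_span ⟨v, h, rfl⟩
      exact (Ideal.Quotient.eq_zero_iff_mem.mpr hv).symm
    · simp [f, g, h]
  have hsurj : Function.Surjective f := by
    intro y
    obtain ⟨y, rfl⟩ := Ideal.Quotient.mk_surjective y
    exact ⟨g y, DFunLike.congr_fun hfg y⟩
  have hdim := ringKrullDim_le_of_surjective f.toRingHom hsurj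
  rw [MvPolynomial.ringKrullDim_of_isNoetherianRing, ringKrullDim_eq_zero_of_field, zero_add]
    at hdim
  have hcard : Nat.card σ = Nat.card {v // v ∉ Z} + Z.card := by
    have := Fintype.ofFinite σ
    rw [Nat.card_eq_fintype_card, Nat.card_eq_fintype_card, Fintype.card_subtype_compl,
      Fintype.card_coe, Nat.sub_add_cancel (Finset.card_le_univ Z)]
  rw [hcard, Nat.cast_add]
  gcongr

/-- A chain of primes over I lies over the variables contained in its smallest member, so it is a
chain in a polynomial ring in at most |σ| - c variables. The set of variables may depend on the
chain. -/
theorem ringKrullDim_quotient_add_le {I : Ideal (MvPolynomial σ K)} {c : ℕ}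
    (h : ∀ Q : Ideal (MvPolynomial σ K), Q.IsPrime → I ≤ Q →
      ∃ Z : Finset σ, c ≤ Z.card ∧ ∀ v ∈ Z, X v ∈ Q) :
    ringKrullDim (MvPolynomial σ K ⧸ I) + c ≤ Nat.card σ := by
  rcases eq_or_ne (ringKrullDim (MvPolynomial σ K ⧸ I)) ⊥ with hb | hb
  · rw [hb, WithBot.bot_add]; exact bot_le
  rw [ringKrullDim_quotient] at hb ⊢
  have hne : Nonempty (PrimeSpectrum.zeroLocus (I : Set (MvPolynomial σ K))) := by
    by_contra hne
    rw [not_nonempty_iff] at hne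
    exact hb Order.krullDim_eq_bot
  have key : ∀ p : LTSeries (PrimeSpectrum.zeroLocus (I : Set (MvPolynomial σ K))),
      p.length + c ≤ Nat.card σ := by
    intro p
    obtain ⟨Z, hZ, hZQ⟩ := h p.head.1.asIdeal p.head.1.isPrime p.head.2
    have hmem : ∀ i, (p i).1 ∈ PrimeSpectrum.zeroLocus
        ((Ideal.span (X '' (Z : Set σ)) : Ideal (MvPolynomial σ K)) : Set (MvPolynomial σ K)) := by
      intro i
      rw [PrimeSpectrum.mem_zeroLocus, SetLike.coe_subset_coe, Ideal.span_le]
      rintro _ ⟨v, hv, rfl⟩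
      exact (LTSeries.head_le p i : p.head.1 ≤ (p i).1) (hZQ v hv)
    let q : LTSeries (PrimeSpectrum.zeroLocus
        ((Ideal.span (X '' (Z : Set σ)) : Ideal (MvPolynomial σ K)) : Set (MvPolynomial σ K))) :=
      ⟨p.length, fun i => ⟨(p i).1, hmem i⟩, fun i => p.step i⟩
    have h1 : (p.length : WithBot ℕ∞) ≤ _ := Order.LTSeries.length_le_krullDim q
    have h2 := ringKrullDim_quotient_span_X_add_le (K := K) Z
    rw [ringKrullDim_quotient] at h2
    have h3 : ((p.length + c : ℕ) : WithBot ℕ∞) ≤ (Nat.card σ : ℕ) := by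
      rw [Nat.cast_add]
      refine le_trans ?_ h2
      gcongr
    exact_mod_cast h3
  rw [Order.krullDim_eq_iSup_length]
  have h4 : (⨆ p : LTSeries (PrimeSpectrum.zeroLocus (I : Set (MvPolynomial σ K))),
      (p.length : ℕ∞)) ≤ ((Nat.card σ - c : ℕ) : ℕ∞) :=
    iSup_le fun p => by have := key p; exact_mod_cast (by omega : p.length ≤ Nat.card σ - c)
  have h5 : c ≤ Nat.card σ := by
    have := key ⟨0, fun _ => hne.some, fun i => i.elim0⟩
    omega
  calc _ ≤ (((Nat.card σ - c : ℕ) : ℕ∞) : WithBot ℕ∞) + c := by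
        gcongr
        exact WithBot.coe_le_coe.mpr h4
    _ = ((Nat.card σ - c + c : ℕ) : WithBot ℕ∞) := by push_cast; rfl
    _ ≤ _ := by rw [Nat.sub_add_cancel h5]

end KrullDimension

/-! ### Codimension of Ferrers ideals -/

namespace FerrerDiagram

variable {p : ℕ} (Φ : FerrerDiagram p) {K : Type*} [Field K]

theorem ideal_le_of_notMem {m : Fin p → ℕ} (hm : m ∉ Φ.boxes) {Z : Finset Φ.Var}
    (hZ : ∀ v : Φ.Var, v.1.2 < m v.1.1 → v ∈ Z) :
    Φ.ideal K ≤ Ideal.span (X '' (Z : Set Φ.Var)) := by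
  rw [ideal, Ideal.span_le]
  rintro _ ⟨i, rfl⟩
  obtain ⟨k, hk⟩ : ∃ k, i.1 k < m k := by
    by_contra! hcon
    exact hm (Φ.isLowerSet hcon i.2)
  exact Ideal.mem_of_dvd _ (Finset.dvd_prod_of_mem _ (Finset.mem_univ k))
    (Ideal.subset_span ⟨_, hZ (Φ.boxVar i k) hk, rfl⟩)

/-- Only an inequality, since a label below m_k need not occur in Φ. -/
theorem card_le_sum {m : Fin p → ℕ} {Z : Finset Φ.Var}
    (hZ : ∀ v ∈ Z, v.1.2 < m v.1.1) : Z.card ≤ ∑ k, m k := by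
  have : (Finset.univ.sigma fun k => Finset.range (m k)).card = ∑ k, m k := by
    rw [Finset.card_sigma]; simp
  rw [← this]
  refine Finset.card_le_card_of_injOn (fun v => ⟨v.1.1, v.1.2⟩) (fun v hv => ?_) ?_
  · simpa using hZ v hv
  · rintro u - v - h
    simp only [Sigma.mk.injEq, heq_eq_eq] at h
    exact Subtype.ext (Prod.ext h.1 h.2)

/-- The variables with labels below m generate a prime over I_Φ, of codimension at most ∑ m_k. -/
theorem le_sum_of_hasCodim {c : ℕ}
    (h : HasCodim K Φ.Var (MvPolynomial Φ.Var K ⧸ Φ.ideal K) c) {m : Fin p → ℕ}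
    (hm : m ∉ Φ.boxes) : c ≤ ∑ k, m k := by
  classical
  have := Fintype.ofFinite Φ.Var
  let Z : Finset Φ.Var := Finset.univ.filter fun v => v.1.2 < m v.1.1
  have h1 := natCard_le_ringKrullDim_quotient_add (K := K)
    (Φ.ideal_le_of_notMem hm (Z := Z) fun v hv => by simpa [Z] using hv)
  have h2 := Φ.card_le_sum (m := m) (Z := Z) fun v hv => by simpa [Z] using hv
  rw [HasCodim, Module.supportDim_quotient_eq_ringKrullDim] at h
  generalize ringKrullDim (MvPolynomial Φ.Var K ⧸ Φ.ideal K) = d at h h1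
  induction d using WithBot.recBotCoe with
  | bot => simp [WithBot.bot_add] at h1
  | coe d =>
    induction d using ENat.recTopCoe with
    | top => exact absurd h (by norm_cast; simp)
    | coe d =>
      norm_cast at h h1
      omega

theorem ringKrullDim_add_le {c : ℕ} (h : ∀ m ∉ Φ.boxes, c ≤ ∑ k, m k) :
    ringKrullDim (MvPolynomial Φ.Var K ⧸ Φ.ideal K) + c ≤ Nat.card Φ.Var := by
  classical
  have := Fintype.ofFinite Φ.Var
  refine ringKrullDim_quotient_add_le fun Q hQ hI => ?_
  let P : Fin p → ℕ → Prop := fun k j => ∃ v : Φ.Var, v.1 = (k, j) ∧ X v ∈ Q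
  have hex : ∀ k, ∃ j, ¬ P k j := by
    intro k
    by_contra! hcon
    have hinj : Function.Injective fun j => (hcon j).choose := by
      intro j j' h
      have h1 := (hcon j).choose_spec.1
      have h2 := (hcon j').choose_spec.1
      simp only at h
      rw [h, h2] at h1
      exact (Prod.ext_iff.mp h1).2.symm
    exact not_injective_infinite_finite _ hinj
  -- In each colour, m_k is the first label whose variable is absent from Q. If m were a box, its
  -- monomial would lie in the prime Q without any of its factors doing so.
  let m : Fin p → ℕ := fun k => Nat.find (hex k)
  have hm : m ∉ Φ.boxes := by
    intro hm
    have hprod : (∏ k, X (Φ.boxVar ⟨m, hm⟩ k) : MvPolynomial Φ.Var K) ∈ Q :=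
      hI (Ideal.subset_span ⟨⟨m, hm⟩, rfl⟩)
    obtain ⟨k, -, hk⟩ := hQ.prod_mem_iff.mp hprod
    exact Nat.find_spec (hex k) ⟨_, rfl, hk⟩
  refine ⟨Finset.univ.filter fun v => X v ∈ Q, (h m hm).trans ?_, fun v hv => by simpa using hv⟩
  have hc : (Finset.univ.sigma fun k => Finset.range (m k)).card = ∑ k, m k := by
    rw [Finset.card_sigma]; simp
  rw [← hc]
  refine (Finset.card_le_card ?_).trans (Finset.card_image_le
    (f := fun v : Φ.Var => (⟨v.1.1, v.1.2⟩ : Σ _ : Fin p, ℕ)))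
  rintro ⟨k, j⟩ hkj
  have hj : P k j := by
    by_contra hcon
    have := Nat.find_min' (hex k) hcon
    simp only [Finset.mem_sigma, Finset.mem_range, m] at hkj
    omega
  obtain ⟨v, hv, hvQ⟩ := hj
  exact Finset.mem_image.mpr ⟨v, by simpa using hvQ, by rw [hv]⟩

end FerrerDiagram

/-! ### The Koszul complex and its vanishing -/

section Koszul

variable {R : Type*} [CommRing R] {σ : Type*} [LinearOrder σ] {M N : Type*} [AddCommGroup M]
  [Module R M] [AddCommGroup N] [Module R N]

variable (R) in
/-- The sign of `v` in the exterior product with the basis element of `U`. -/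
def koszulSign (v : σ) (U : Finset σ) : R := (-1) ^ (U.filter (· < v)).card

theorem koszulSign_mul_self (v : σ) (U : Finset σ) : koszulSign R v U * koszulSign R v U = 1 := by
  rw [koszulSign, ← mul_pow]; simp

theorem koszulSign_insert {v w : σ} {U : Finset σ} (hv : v ∉ U) :
    koszulSign R w (insert v U) = (if v < w then -1 else 1) * koszulSign R w U := by
  rw [koszulSign, koszulSign, Finset.filter_insert]
  split_ifs with h
  · rw [Finset.card_insert_of_notMem (fun h' => hv (Finset.mem_filter.mp h').1), pow_succ, mul_comm]
  · rw [one_mul]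

/-- Exactly one of v < w and w < v holds, so exactly one of the two insertions changes a sign. -/
theorem koszulSign_swap {v w : σ} {U : Finset σ} (hv : v ∉ U) (hw : w ∉ U) (hvw : v ≠ w) :
    koszulSign R v U * koszulSign R w (insert v U) =
      -(koszulSign R w U * koszulSign R v (insert w U)) := by
  rw [koszulSign_insert hv, koszulSign_insert hw]
  rcases lt_or_gt_of_ne hvw with h | h
  · rw [if_pos h, if_neg h.not_gt]; ring
  · rw [if_pos h, if_neg h.not_gt]; ring

theorem koszulSign_insert_mul_insert {v w : σ} {U : Finset σ} (hv : v ∉ U) (hw : w ∉ U)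
    (hvw : v ≠ w) : koszulSign R w (insert v U) * koszulSign R v (insert w U) =
      -(koszulSign R v U * koszulSign R w U) := by
  rw [koszulSign_insert hv, koszulSign_insert hw]
  rcases lt_or_gt_of_ne hvw with h | h
  · rw [if_pos h, if_neg h.not_gt]; ring
  · rw [if_pos h, if_neg h.not_gt]; ring

variable [Fintype σ]

/-- The differential of the Koszul complex of the family `x` with coefficients in `M`. A chain is
given by its coefficients at the basis elements `e_U`, for `U ⊆ σ`. -/
def koszulD (x : σ → R) : (Finset σ → M) →ₗ[R] (Finset σ → M) :=
  LinearMap.pi fun U => ∑ v ∈ Uᶜ, (koszulSign R v U * x v) • LinearMap.proj (insert v U)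

theorem koszulD_apply (x : σ → R) (z : Finset σ → M) (U : Finset σ) :
    koszulD x z U = ∑ v ∈ Uᶜ, (koszulSign R v U * x v) • z (insert v U) := by
  simp [koszulD]

theorem koszulD_comp (x : σ → R) (φ : M →ₗ[R] N) (z : Finset σ → M) :
    koszulD x (φ ∘ z) = φ ∘ koszulD x z := by
  ext1 U
  simp [koszulD_apply]

theorem koszulD_sum {κ : Type*} (s : Finset κ) (x : κ → σ → R) (z : Finset σ → M) :
    koszulD (fun v => ∑ k ∈ s, x k v) z = ∑ k ∈ s, koszulD (x k) z := by
  ext1 U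
  simp only [Finset.sum_apply, koszulD_apply, Finset.mul_sum, Finset.sum_smul]
  exact Finset.sum_comm

theorem koszulD_koszulD_apply (x y : σ → R) (z : Finset σ → M) (U : Finset σ) :
    koszulD x (koszulD y z) U = ∑ v, ∑ w, if v ∉ U ∧ w ∉ U ∧ v ≠ w then
      (koszulSign R v U * koszulSign R w (insert v U) * (x v * y w)) •
        z (insert w (insert v U)) else 0 := by
  rw [koszulD_apply]
  simp only [koszulD_apply, Finset.smul_sum, smul_smul]
  rw [← Finset.sum_subset (Finset.subset_univ Uᶜ)]
  · refine Finset.sum_congr rfl fun v hv => ?_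
    rw [Finset.mem_compl] at hv
    rw [← Finset.sum_subset (Finset.subset_univ (insert v U)ᶜ)]
    · refine Finset.sum_congr rfl fun w hw => ?_
      simp only [Finset.mem_compl, Finset.mem_insert, not_or] at hw
      rw [if_pos ⟨hv, hw.2, Ne.symm hw.1⟩]
      congr 1
      ring
    · intro w _ hw
      rw [if_neg]
      simp only [Finset.mem_compl, Finset.mem_insert, not_or, not_and, not_not] at hw
      rintro ⟨-, h1, h2⟩
      exact h1 (hw (Ne.symm h2))
  · intro v _ hv
    refine Finset.sum_eq_zero fun w _ => if_neg ?_
    rintro ⟨h, -⟩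
    exact hv (Finset.mem_compl.mpr h)

theorem koszulD_anticomm (x y : σ → R) (z : Finset σ → M) :
    koszulD x (koszulD y z) = -koszulD y (koszulD x z) := by
  ext1 U
  rw [Pi.neg_apply, koszulD_koszulD_apply, koszulD_koszulD_apply, Finset.sum_comm,
    ← Finset.sum_neg_distrib]
  refine Finset.sum_congr rfl fun v _ => ?_
  rw [← Finset.sum_neg_distrib]
  refine Finset.sum_congr rfl fun w _ => ?_
  by_cases h : v ∉ U ∧ w ∉ U ∧ v ≠ w
  · rw [if_pos h, if_pos ⟨h.2.1, h.1, h.2.2.symm⟩, ← neg_smul, Finset.insert_comm,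
      koszulSign_swap h.2.1 h.1 h.2.2.symm]
    congr 1
    ring
  · rw [if_neg h, if_neg (fun h' => h ⟨h'.2.1, h'.1, h'.2.2.symm⟩), neg_zero]

/-- Anticommutation yields only that twice the square vanishes, which is void in characteristic two;
here the terms for (v, w) and (w, v) are cancelled directly. -/
theorem koszulD_koszulD (x : σ → R) (z : Finset σ → M) : koszulD x (koszulD x z) = 0 := by
  ext1 U
  rw [koszulD_koszulD_apply, ← Finset.sum_product', Pi.zero_apply]
  refine Finset.sum_involution (fun a _ => (a.2, a.1)) ?_ ?_ (fun a _ => Finset.mem_univ _)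
    (fun a _ => rfl)
  · rintro ⟨v, w⟩ -
    simp only
    by_cases h : v ∉ U ∧ w ∉ U ∧ v ≠ w
    · rw [if_pos h, if_pos ⟨h.2.1, h.1, h.2.2.symm⟩, Finset.insert_comm v w, ← add_smul,
        koszulSign_swap h.1 h.2.1 h.2.2]
      convert zero_smul R _
      ring
    · rw [if_neg h, if_neg (fun h' => h ⟨h'.2.1, h'.1, h'.2.2.symm⟩), add_zero]
  · rintro ⟨v, w⟩ - h hvw
    have e : w = v := congrArg Prod.fst hvw
    subst e
    simp at h

variable (R) in
/-- Exterior multiplication by the basis element `e_v`. -/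
def koszulWedge (v : σ) (z : Finset σ → M) : Finset σ → M := fun U =>
  if v ∈ U then koszulSign R v (U.erase v) • z (U.erase v) else 0

/-- The differential is an antiderivation. Hence exterior multiplication by e_v is a homotopy from
multiplication by x_v to zero, and the ideal generated by the family annihilates Koszul homology. -/
theorem koszulD_koszulWedge (x : σ → R) (v : σ) (z : Finset σ → M) :
    koszulD x (koszulWedge R v z) = x v • z - koszulWedge R v (koszulD x z) := by
  ext1 U
  rw [koszulD_apply, Pi.sub_apply, Pi.smul_apply]
  by_cases hv : v ∈ U
  · obtain ⟨V, hV, rfl⟩ : ∃ V, v ∉ V ∧ U = insert v V :=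
      ⟨U.erase v, Finset.notMem_erase _ _, (Finset.insert_erase hv).symm⟩
    rw [koszulWedge, if_pos hv, Finset.erase_insert hV, koszulD_apply]
    have e : Vᶜ = insert v (insert v V)ᶜ := by
      ext w; by_cases h : w = v <;> simp [h, hV]
    rw [e, Finset.sum_insert (by simp), smul_add, smul_smul, ← mul_assoc, koszulSign_mul_self,
      one_mul, sub_add_eq_sub_sub, sub_self, zero_sub, Finset.smul_sum, ← Finset.sum_neg_distrib]
    refine Finset.sum_congr rfl fun w hw => ?_
    simp only [Finset.mem_compl, Finset.mem_insert, not_or] at hw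
    have h1 : (insert w (insert v V)).erase v = insert w V := by
      rw [Finset.insert_comm, Finset.erase_insert]
      simp [hV, Ne.symm hw.1]
    rw [koszulWedge, if_pos (by simp), h1, smul_smul, smul_smul, ← neg_smul]
    congr 1
    have := koszulSign_insert_mul_insert (R := R) hV hw.2 (Ne.symm hw.1)
    linear_combination x w * this
  · rw [koszulWedge, if_neg hv, sub_zero, Finset.sum_eq_single v]
    · rw [koszulWedge, if_pos (Finset.mem_insert_self _ _), Finset.erase_insert hv, smul_smul,
        mul_right_comm, koszulSign_mul_self, one_mul]
    · intro w _ hw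
      rw [koszulWedge, if_neg, smul_zero]
      simp [hv, Ne.symm hw]
    · intro h
      exact absurd (Finset.mem_compl.mpr hv) h

/-- The Koszul homology of a module with a weakly regular sequence of length `d` in the ideal
generated by the family vanishes in degrees larger than `|σ| - d`. -/
theorem exists_koszulD_eq (x : σ → R) {rs : List R} (hx : ∀ r ∈ rs, r ∈ Ideal.span (Set.range x))
    (hreg : RingTheory.Sequence.IsWeaklyRegular M rs) {z : Finset σ → M}
    (hz : ∀ U, z U ≠ 0 → Fintype.card σ < U.card + rs.length) (hd : koszulD x z = 0) :
    ∃ y, koszulD x y = z := by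
  induction rs generalizing M with
  | nil =>
    refine ⟨0, ?_⟩
    rw [map_zero]
    ext1 U
    by_contra h
    have := hz U (Ne.symm h)
    have := Finset.card_le_univ U
    simp only [List.length_nil] at *
    omega
  | cons f rs ih =>
    rw [RingTheory.Sequence.isWeaklyRegular_cons_iff] at hreg
    obtain ⟨g, hg⟩ := Ideal.mem_span_range_iff_exists_fun.mp (hx f List.mem_cons_self)
    -- Writing f in terms of the family gives a chain w with dw = fz. Modulo f it is a cycle one
    -- degree higher than z, so the shorter sequence applies to it.
    let w : Finset σ → M := ∑ v, g v • koszulWedge R v z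
    have hw : koszulD x w = f • z := by
      simp only [w, map_sum, map_smul, koszulD_koszulWedge, hd]
      have : ∀ v, koszulWedge R v (0 : Finset σ → M) = 0 := fun v => by
        ext1 U; simp [koszulWedge]
      simp only [this, sub_zero, smul_smul, ← Finset.sum_smul, hg]
    let π : M →ₗ[R] QuotSMulTop f M := Submodule.mkQ _
    have hπ : ∀ m : M, π (f • m) = 0 := fun m =>
      (Submodule.Quotient.mk_eq_zero _).mpr (Submodule.smul_mem_pointwise_smul _ _ _ trivial)
    obtain ⟨u', hu'⟩ := ih (M := QuotSMulTop f M) (z := π ∘ w)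
      (fun r hr => hx r (List.mem_cons_of_mem _ hr)) hreg.2 (fun U hU => by
        have h1 : w U ≠ 0 := fun h => hU (by rw [Function.comp_apply, h, map_zero])
        simp only [w, Finset.sum_apply] at h1
        obtain ⟨v, -, hv⟩ := Finset.exists_ne_zero_of_sum_ne_zero h1
        have h2 : koszulWedge R v z U ≠ 0 := fun h => hv (by rw [Pi.smul_apply, h, smul_zero])
        rw [koszulWedge] at h2
        have hvU : v ∈ U := by
          by_contra hvU
          exact h2 (if_neg hvU)
        rw [if_pos hvU] at h2
        have h3 := hz (U.erase v) fun h => h2 (by rw [h, smul_zero])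
        rw [Finset.card_erase_of_mem hvU, List.length_cons] at h3
        have := Finset.card_pos.mpr ⟨v, hvU⟩
        omega)
      (by
        rw [koszulD_comp, hw]
        ext1 U
        exact hπ _)
    choose u hu using fun U => Submodule.mkQ_surjective _ (u' U)
    have hu2 : π ∘ koszulD x u = π ∘ w := by
      rw [← koszulD_comp, ← hu']
      congr 1
      exact funext hu
    -- A lift u of the bounding chain modulo f gives w - du = fy. Then f dy = dw = fz, and f can be
    -- cancelled.
    have hy : ∀ U, ∃ y, f • y = w U - koszulD x u U := by
      intro U
      have h1 : π (w U - koszulD x u U) = 0 := by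
        rw [map_sub]
        exact sub_eq_zero.mpr (congrFun hu2 U).symm
      obtain ⟨y, -, hy⟩ := (Submodule.mem_smul_pointwise_iff_exists _ _ _).mp
        ((Submodule.Quotient.mk_eq_zero _).mp h1)
      exact ⟨y, hy⟩
    choose y hy using hy
    refine ⟨y, ?_⟩
    have h1 : f • koszulD x y = f • z := by
      rw [← map_smul, ← hw]
      have : f • y = w - koszulD x u := funext hy
      rw [this, map_sub, koszulD_koszulD, sub_zero]
    ext1 U
    exact hreg.1 (congrFun h1 U)

end Koszul

/-! ### Koszul cycles built from colours -/

section ColouredKoszul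

variable {K : Type*} [Field K] {σ : Type*} [LinearOrder σ] [Fintype σ] {κ : Type*} [DecidableEq κ]

variable (K) in
/-- The family of the variables of colour `k`, extended by zero. -/
noncomputable def colourVar (col : σ → κ) (k : κ) (v : σ) : MvPolynomial σ K :=
  if col v = k then X v else 0

variable (K) in
/-- The Koszul chain obtained from the basis element `e_W` by the differentials with respect to the
variables of the colours in a list. -/
noncomputable def colourChain (col : σ → κ) (W : Finset σ) : List κ →
    Finset σ → MvPolynomial σ K
  | [] => Pi.single W 1
  | k :: l => koszulD (colourVar K col k) (colourChain col W l)

variable {col : σ → κ} {W : Finset σ}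

theorem colourChain_support {l : List κ} {U : Finset σ} (h : colourChain K col W l U ≠ 0) :
    U ⊆ W ∧ U.card + l.length = W.card := by
  induction l generalizing U with
  | nil =>
    have : U = W := by
      by_contra hU
      exact h (Pi.single_eq_of_ne hU _)
    subst this
    simp
  | cons k l ih =>
    rw [colourChain, koszulD_apply] at h
    obtain ⟨v, hv, hne⟩ := Finset.exists_ne_zero_of_sum_ne_zero h
    obtain ⟨h1, h2⟩ := ih fun h0 => hne (by rw [h0, smul_zero])
    rw [Finset.card_insert_of_notMem (Finset.mem_compl.mp hv)] at h2
    exact ⟨(Finset.subset_insert _ _).trans h1, by rw [List.length_cons]; omega⟩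

theorem colourChain_mem (l : List κ) (U : Finset σ) : colourChain K col W l U ∈
    (l.map fun k => Ideal.span (X '' {v | v ∈ W ∧ col v = k} : Set (MvPolynomial σ K))).prod := by
  induction l generalizing U with
  | nil => simp
  | cons k l ih =>
    rw [colourChain, koszulD_apply, List.map_cons, List.prod_cons]
    refine Ideal.sum_mem _ fun v _ => ?_
    by_cases h0 : colourChain K col W l (insert v U) = 0
    · rw [h0, smul_zero]; exact Ideal.zero_mem _
    · rw [smul_eq_mul, mul_assoc]
      refine Ideal.mul_mem_left _ _ (Ideal.mul_mem_mul ?_ (ih _))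
      rw [colourVar]
      split_ifs with hk
      · exact Ideal.subset_span
          ⟨v, ⟨(colourChain_support h0).1 (Finset.mem_insert_self _ _), hk⟩, rfl⟩
      · exact Ideal.zero_mem _

/-- The differential of colour k anticommutes past the others until it meets its own copy, where the
square is zero. -/
theorem koszulD_colourChain_of_mem {k : κ} {l : List κ} (h : k ∈ l) :
    koszulD (colourVar K col k) (colourChain K col W l) = 0 := by
  induction l with
  | nil => simp at h
  | cons k' l ih =>
    rw [colourChain]
    by_cases hk : k = k'
    · rw [hk, koszulD_koszulD]
    · rw [koszulD_anticomm, ih ((List.mem_cons.mp h).resolve_left hk), map_zero, neg_zero]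

/-- The only way from W to the complement of the transversal w, deleting one variable of each listed
colour, is to delete w k in colour k. So a single product survives, up to a sign recorded as a unit.
-/
theorem colourChain_sdiff {w : κ → σ} (hwW : ∀ k, w k ∈ W) (hw : ∀ k, col (w k) = k)
    {l : List κ} (hl : l.Nodup) :
    ∃ ε : MvPolynomial σ K, IsUnit ε ∧
      colourChain K col W l (W \ (l.map w).toFinset) = ε * (l.map fun k => X (w k)).prod := by
  induction l with
  | nil => exact ⟨1, isUnit_one, by simp [colourChain]⟩
  | cons k l ih =>
    obtain ⟨ε, hε, e⟩ := ih (List.nodup_cons.mp hl).2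
    have hk := (List.nodup_cons.mp hl).1
    set U := W \ ((k :: l).map w).toFinset with hU
    have hwU : w k ∉ U := by simp [hU]
    have hins : insert (w k) U = W \ (l.map w).toFinset := by
      rw [hU]
      ext v
      simp only [List.map_cons, List.toFinset_cons, Finset.mem_insert, Finset.mem_sdiff,
        List.mem_toFinset, List.mem_map, not_or, not_exists, not_and]
      constructor
      · rintro (rfl | ⟨h1, h2, h3⟩)
        · refine ⟨hwW k, fun k' hk' h => hk ?_⟩
          rw [← hw k, ← h, hw]
          exact hk'
        · exact ⟨h1, h3⟩
      · rintro ⟨h1, h2⟩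
        by_cases hv : v = w k
        · exact Or.inl hv
        · exact Or.inr ⟨h1, hv, h2⟩
    refine ⟨koszulSign _ (w k) U * ε,
      (IsUnit.of_mul_eq_one _ (koszulSign_mul_self _ _)).mul hε, ?_⟩
    rw [colourChain, koszulD_apply, Finset.sum_eq_single (w k)]
    · rw [hins, e, colourVar, if_pos (hw k), List.map_cons, List.prod_cons, smul_eq_mul]
      ring
    · intro v hv hvk
      by_cases hcol : col v = k
      · by_cases hvW : v ∈ W
        · exfalso
          rw [Finset.mem_compl, hU] at hv
          simp only [List.map_cons, List.toFinset_cons, Finset.mem_insert, Finset.mem_sdiff,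
            List.mem_toFinset, List.mem_map, not_or, not_and, not_not] at hv
          obtain ⟨k', hk', rfl⟩ := hv hvW hvk
          rw [hw] at hcol
          exact hvk (by rw [hcol])
        · have : colourChain K col W l (insert v U) = 0 := by
            by_contra h0
            exact hvW ((colourChain_support h0).1 (Finset.mem_insert_self _ _))
          rw [this, smul_zero]
      · rw [colourVar, if_neg hcol, mul_zero, zero_smul]
    · intro h
      exact absurd (Finset.mem_compl.mpr hwU) h

variable [Fintype κ]

theorem koszulD_X_eq_sum (col : σ → κ) (z : Finset σ → MvPolynomial σ K) :
    koszulD (X : σ → MvPolynomial σ K) z = ∑ k, koszulD (colourVar K col k) z := by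
  rw [← koszulD_sum]
  congr 2
  ext1 v
  simp [colourVar]

/-- The full differential is the sum of its coloured parts, and every colour in l contributes zero.
-/
theorem koszulD_colourChain_cons {k : κ} {l : List κ} (h' : ∀ k', k' ∈ k :: l) :
    koszulD (X : σ → MvPolynomial σ K) (colourChain K col W l) = colourChain K col W (k :: l) := by
  rw [koszulD_X_eq_sum col, Finset.sum_eq_single k]
  · rfl
  · intro k' _ hk
    exact koszulD_colourChain_of_mem ((List.mem_cons.mp (h' k')).resolve_left hk)
  · simp

/-- A nonzero Koszul homology class of `S ⧸ I` of degree `|W| - |κ| + 1`. -/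
theorem not_exists_koszulD_eq {w : κ → σ} (hwW : ∀ k, w k ∈ W) (hw : ∀ k, col (w k) = k)
    {I : Ideal (MvPolynomial σ K)} {T : σ →₀ ℕ} (hT : monomial T (1 : K) = ∏ k, X (w k))
    (hI : ∀ f ∈ I, ∀ v, coeff T (X v * f) = 0) {k : κ} {l : List κ} (h : (k :: l).Nodup)
    (h' : ∀ k', k' ∈ k :: l) :
    ¬ ∃ y : Finset σ → MvPolynomial σ K ⧸ I,
      koszulD (X : σ → MvPolynomial σ K) y = Submodule.mkQ I ∘ colourChain K col W l := by
  rintro ⟨y, hy⟩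
  choose u hu using fun U => Submodule.mkQ_surjective I (y U)
  have hu' : Submodule.mkQ I ∘ u = y := funext hu
  rw [← hu', koszulD_comp] at hy
  have hmem : ∀ U, (colourChain K col W l - koszulD (X : σ → MvPolynomial σ K) u) U ∈ I := by
    intro U
    rw [← Submodule.Quotient.mk_eq_zero, Pi.sub_apply, Submodule.Quotient.mk_sub, sub_eq_zero]
    exact (congrFun hy U).symm
  obtain ⟨ε, hε, e⟩ := colourChain_sdiff (K := K) hwW hw h
  have hprod : ((k :: l).map fun k => (X (w k) : MvPolynomial σ K)).prod = monomial T 1 := by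
    rw [hT, ← List.prod_toFinset _ h]
    congr 1
    ext k'
    simpa using h' k'
  rw [hprod, ← koszulD_colourChain_cons h'] at e
  -- The boundary du is invisible to the differential, so the distinguished coefficient is that of
  -- the differential of a chain over I. It is a combination of elements x_v f with f in I, whose
  -- coefficient at T vanishes.
  have e2 : koszulD (X : σ → MvPolynomial σ K) (colourChain K col W l) =
      koszulD (X : σ → MvPolynomial σ K)
        (colourChain K col W l - koszulD (X : σ → MvPolynomial σ K) u) := by
    rw [map_sub, koszulD_koszulD, sub_zero]
  rw [e2, koszulD_apply] at e
  obtain ⟨δ, hδ⟩ := hε.exists_left_inv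
  have e3 := congrArg (fun f => coeff T (δ * f)) e
  simp only [← mul_assoc, hδ, one_mul, coeff_monomial, if_true, Finset.mul_sum, coeff_sum] at e3
  refine zero_ne_one (α := K) (Eq.trans (Finset.sum_eq_zero fun v _ => ?_).symm e3)
  have : δ * ((koszulSign (MvPolynomial σ K) v (W \ ((k :: l).map w).toFinset) * X v) •
      (colourChain K col W l - koszulD (X : σ → MvPolynomial σ K) u)
        (insert v (W \ ((k :: l).map w).toFinset))) =
      X v * (δ * koszulSign (MvPolynomial σ K) v (W \ ((k :: l).map w).toFinset) *
      (colourChain K col W l - koszulD (X : σ → MvPolynomial σ K) u)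
        (insert v (W \ ((k :: l).map w).toFinset))) := by
    rw [smul_eq_mul]; ring
  rw [this]
  exact hI _ (I.mul_mem_left _ (hmem _)) v

end ColouredKoszul

/-! ### Boxes of a Cohen–Macaulay diagram -/

namespace FerrerDiagram

variable {p : ℕ} (Φ : FerrerDiagram p) {K : Type*} [Field K]

theorem prod_X_boxVar (i : Φ.boxes) : (∏ k, X (Φ.boxVar i k) : MvPolynomial Φ.Var K) =
    monomial (∑ k, Finsupp.single (Φ.boxVar i k) 1) 1 := by
  rw [monomial_sum_one]; rfl

theorem coeff_eq_zero_of_mem_ideal {f : MvPolynomial Φ.Var K} (hf : f ∈ Φ.ideal K)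
    {m : Φ.Var →₀ ℕ} (hm : m.degree < p) : coeff m f = 0 := by
  have e : Φ.ideal K =
      monomialIdeal K (Set.range fun i => ∑ k, Finsupp.single (Φ.boxVar i k) 1) := by
    rw [ideal, monomialIdeal, ← Set.range_comp]
    congr 2
    ext1 i
    exact Φ.prod_X_boxVar i
  rw [e, mem_monomialIdeal] at hf
  by_contra h
  obtain ⟨_, ⟨i, rfl⟩, hi⟩ := hf m (mem_support_iff.mpr h)
  have h1 := Finsupp.degree_mono hi
  simp [map_sum] at h1
  omega

/-- A box with label sum at least c would give a nonzero Koszul class in a degree larger than the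
codimension, contradicting the depth. -/
theorem sum_lt_of_isCohenMacaulay (hp : 0 < p) {c : ℕ} (h : Φ.IsCohenMacaulayOfCodim K c)
    {b : Fin p → ℕ} (hb : b ∈ Φ.boxes) : ∑ k, b k < c := by
  classical
  by_contra! hcon
  obtain ⟨⟨rs, hrs, hreg, hdim⟩, hcodim⟩ := h
  rw [HasCodim, hdim] at hcodim
  have hn : rs.length + c = Nat.card Φ.Var := by exact_mod_cast hcodim
  let inst : Fintype Φ.Var := Fintype.ofFinite _
  let inst2 : LinearOrder Φ.Var :=
    LinearOrder.lift' (fun v => toLex v.1) (fun u v h => Subtype.ext (toLex.injective h))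
  rw [Nat.card_eq_fintype_card] at hn
  let col : Φ.Var → Fin p := fun v => v.1.1
  let W : Finset Φ.Var := Finset.univ.filter fun v => v.1.2 ≤ b v.1.1
  have hvar : ∀ k j, j ≤ b k → ∃ v : Φ.Var, v.1 = (k, j) := fun k j hj =>
    ⟨⟨(k, j), Function.update b k j, Φ.isLowerSet (fun l => by
      by_cases hl : l = k
      · subst hl; simpa using hj
      · simp [hl]) hb, by simp⟩, rfl⟩
  have hW : ∑ k, b k + p ≤ W.card := by
    have hc : (Finset.univ.sigma fun k => Finset.range (b k + 1)).card = ∑ k, b k + p := by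
      rw [Finset.card_sigma]
      simp [Finset.sum_add_distrib]
    rw [← hc]
    refine (Finset.card_le_card ?_).trans (Finset.card_image_le
      (f := fun v : Φ.Var => (⟨v.1.1, v.1.2⟩ : Σ _ : Fin p, ℕ)))
    rintro ⟨k, j⟩ hkj
    have hj : j ≤ b k := by simpa [Nat.lt_succ_iff] using hkj
    obtain ⟨v, hv⟩ := hvar k j hj
    exact Finset.mem_image.mpr ⟨v, by simp [W, hv, hj], by rw [hv]⟩
  let w : Fin p → Φ.Var := Φ.boxVar ⟨b, hb⟩
  let k₀ : Fin p := ⟨0, hp⟩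
  -- All colours but one: the cycle has degree |W| - (p - 1) ≥ ∑ b_k + 1, while applying the last
  -- colour as well lands in I_Φ.
  let l : List (Fin p) := (Finset.univ.erase k₀).toList
  have hl : (k₀ :: l).Nodup := List.nodup_cons.mpr ⟨by simp [l], Finset.nodup_toList _⟩
  have hl' : ∀ k, k ∈ k₀ :: l := fun k => by simp [l]; tauto
  have hlen : l.length + 1 = p := by
    simp only [l, Finset.length_toList, Finset.card_erase_of_mem (Finset.mem_univ _),
      Finset.card_univ, Fintype.card_fin]
    omega
  refine not_exists_koszulD_eq (K := K) (W := W) (w := w) (col := col) (I := Φ.ideal K)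
    (fun k => Finset.mem_filter.mpr ⟨Finset.mem_univ _, le_rfl⟩) (fun k => rfl)
    (Φ.prod_X_boxVar ⟨b, hb⟩).symm ?_ hl hl'
    (exists_koszulD_eq X hrs hreg.toIsWeaklyRegular ?_ ?_)
  -- Removing one variable from the monomial of b leaves degree p - 1, below the degree of every
  -- generator of I_Φ.
  · intro f hf v
    rw [coeff_X_mul']
    split_ifs with hv
    · refine Φ.coeff_eq_zero_of_mem_ideal hf ?_
      have h1 : Finsupp.single v 1 ≤ ∑ k, Finsupp.single (Φ.boxVar ⟨b, hb⟩ k) 1 := by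
        rw [Finsupp.single_le_iff]
        exact Nat.one_le_iff_ne_zero.mpr (Finsupp.mem_support_iff.mp hv)
      have h2 := congrArg Finsupp.degree (tsub_add_cancel_of_le h1)
      rw [map_add, map_sum] at h2
      simp at h2
      omega
    · rfl
  · intro U hU
    have h0 : colourChain K col W l U ≠ 0 := fun h0 => hU (by
      rw [Function.comp_apply, h0, map_zero])
    have := (colourChain_support h0).2
    omega
  · rw [koszulD_comp, koszulD_colourChain_cons hl']
    ext1 U
    refine (Submodule.Quotient.mk_eq_zero _).mpr ?_
    refine (?_ : _ ≤ Φ.ideal K) (colourChain_mem (k₀ :: l) U)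
    have hprod : ((k₀ :: l).map fun k => Ideal.span
        (X '' {v | v ∈ W ∧ col v = k} : Set (MvPolynomial Φ.Var K))).prod =
        ∏ k, Ideal.span (X '' {v | v ∈ W ∧ col v = k}) := by
      rw [← List.prod_toFinset _ hl]
      congr 1
      ext k
      simpa using hl' k
    rw [hprod, Ideal.prod_span, Ideal.span_le]
    intro f hf
    obtain ⟨g, hg, rfl⟩ := (Set.mem_fintype_prod _ _).mp hf
    choose u hu hug using hg
    -- One variable of each colour taken from W gives a box below b, so the product of the coloured
    -- ideals lies in I_Φ.
    have hbox : (fun k => (u k).1.2) ∈ Φ.boxes := by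
      refine Φ.isLowerSet (fun k => ?_) hb
      obtain ⟨h1, h2⟩ := hu k
      simp only [W, Finset.mem_filter, Finset.mem_univ, true_and] at h1
      change (u k).1.1 = k at h2
      rwa [h2] at h1
    refine Ideal.subset_span ⟨⟨_, hbox⟩, ?_⟩
    refine Finset.prod_congr rfl fun k _ => ?_
    rw [← hug k]
    congr 1
    exact Subtype.ext (Prod.ext (hu k).2.symm rfl)

end FerrerDiagram

/-! ### From the ideal to its quotient -/

section AugmentedResolution

open Matrix

variable {K : Type*} [Field K] {σ : Type*} {I : Ideal (MvPolynomial σ K)} {g α : ℕ}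

namespace LinearResolution

/-- The index types of the resolution of `S ⧸ I`. -/
def augIndex (P : LinearResolution I g α) : ℕ → Type
  | 0 => Unit
  | i + 1 => P.ι i

instance (P : LinearResolution I g α) : ∀ i, Fintype (P.augIndex i)
  | 0 => inferInstanceAs (Fintype Unit)
  | i + 1 => inferInstanceAs (Fintype (P.ι i))

/-- The matrices of the resolution of `S ⧸ I`. -/
def augD (P : LinearResolution I g α) :
    ∀ i, Matrix (P.augIndex i) (P.augIndex (i + 1)) (MvPolynomial σ K)
  | 0 => P.a
  | i + 1 => P.d i

theorem augD_hom (P : LinearResolution I g α) :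
    ∀ i k j, (P.augD i k j).IsHomogeneous (if i = 0 then g else α)
  | 0 => P.a_hom
  | i + 1 => P.d_hom i

theorem card_augIndex (P : LinearResolution I g α) :
    ∀ i, Fintype.card (P.augIndex i) = if i = 0 then 1 else Fintype.card (P.ι (i - 1))
  | 0 => rfl
  | _ + 1 => rfl

theorem augD_exact (P : LinearResolution I g α) :
    ∀ i, Function.Exact (P.augD (i + 1)).mulVecLin (P.augD i).mulVecLin
  | 0 => P.exact_zero
  | i + 1 => P.exact_succ i

/-- The augmentation `S → S ⧸ I`. -/
noncomputable def aug (P : LinearResolution I g α) :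
    (P.augIndex 0 → MvPolynomial σ K) →ₗ[MvPolynomial σ K] MvPolynomial σ K ⧸ I :=
  Submodule.mkQ I ∘ₗ LinearMap.proj (φ := fun _ : Unit => MvPolynomial σ K) ()

theorem aug_exact (P : LinearResolution I g α) :
    Function.Exact (P.augD 0).mulVecLin P.aug := by
  intro x
  refine (Submodule.Quotient.mk_eq_zero (p := I)).trans ((P.mem_iff _).trans ?_)
  exact Iff.rfl

theorem hasPureResolution (P : LinearResolution I g α) {s : ℕ} {a : ℕ → ℕ}
    (ha : ∀ i < s, a i < a (i + 1)) (h0 : a 0 = 0) (h1 : a 1 = g)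
    (hα : ∀ i, a (i + 2) = a (i + 1) + α) {β : ℕ → ℕ}
    (hβ : ∀ i, Fintype.card (P.augIndex i) = β i) (hpos : ∀ i, 0 < β i ↔ i ≤ s) :
    HasPureResolution σ (quotientGrading I) s a β := by
  classical
  refine hasPureResolution_of_fintype (ι := P.augIndex) hβ ha hpos P.augD P.aug ?_ ?_ ?_
    P.aug_exact P.augD_exact
  · intro i k j
    have := P.augD_hom i k j
    rcases i with _ | i
    · rwa [h0, h1, Nat.sub_zero]
    · rwa [hα, Nat.add_sub_cancel_left]
  · intro j
    rw [h0]
    refine ⟨1, (mem_homogeneousSubmodule _ _).mpr (isHomogeneous_one _ _), ?_⟩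
    have h : (1 : MvPolynomial σ K) = (Pi.single j 1 : P.augIndex 0 → MvPolynomial σ K) j :=
      (Pi.single_eq_same (M := fun _ : P.augIndex 0 => MvPolynomial σ K) j 1).symm
    exact congrArg (Submodule.mkQ I) h
  · intro y
    obtain ⟨y, rfl⟩ := Submodule.mkQ_surjective I y
    exact ⟨fun _ => y, rfl⟩

end LinearResolution

end AugmentedResolution

/-! ### The simplex diagram is the Cohen–Macaulay one -/

namespace FerrerDiagram

variable {p : ℕ} (Φ : FerrerDiagram p) {K : Type*} [Field K]

open Classical in
/-- The exponent of the variable with labels `k`, `j`, or zero if there is no such variable. -/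
noncomputable def varExponent (k j : ℕ) : Φ.Var →₀ ℕ :=
  if h : ∃ v : Φ.Var, v.1.1 = k ∧ v.1.2 = j then Finsupp.single h.choose 1 else 0

theorem varExponent_var (v : Φ.Var) : Φ.varExponent v.1.1 v.1.2 = Finsupp.single v 1 := by
  have h : ∃ u : Φ.Var, (u.1.1 : ℕ) = v.1.1 ∧ u.1.2 = v.1.2 := ⟨v, rfl, rfl⟩
  rw [varExponent, dif_pos h]
  congr 1
  exact Subtype.ext (Prod.ext (Fin.ext h.choose_spec.1) h.choose_spec.2)

theorem varExponent_apply (k j : ℕ) (v : Φ.Var) :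
    Φ.varExponent k j v = if v.1.1 = k ∧ v.1.2 = j then 1 else 0 := by
  classical
  split_ifs with h
  · rw [← h.1, ← h.2, varExponent_var, Finsupp.single_eq_same]
  · rw [varExponent]
    split_ifs with h'
    · refine Finsupp.single_eq_of_ne fun e => h ?_
      rw [e]
      exact h'.choose_spec
    · rfl

theorem disjoint_varExponent {k l j i : ℕ} (h : (k, j) ≠ (l, i)) :
    Disjoint (Φ.varExponent k j) (Φ.varExponent l i) := by
  classical
  rw [Finsupp.disjoint_iff, Finset.disjoint_left]
  intro v hv hv'
  rw [Finsupp.mem_support_iff, varExponent_apply] at hv hv'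
  have h1 := (ite_ne_right_iff.mp hv).1
  have h2 := (ite_ne_right_iff.mp hv').1
  exact h (by rw [← h1.1, ← h1.2, ← h2.1, ← h2.2])

theorem sum_varExponent [Fintype Φ.Var] (m : Fin p → ℕ) :
    ∑ k, ∑ j ∈ Finset.range (m k), Φ.varExponent k j =
      ∑ v ∈ Finset.univ.filter (fun v : Φ.Var => v.1.2 < m v.1.1), Finsupp.single v 1 := by
  classical
  ext v
  simp only [Finsupp.finsetSum_apply, varExponent_apply, Finsupp.single_apply]
  rw [Finset.sum_eq_single v.1.1]
  · simp
  · intro k _ hk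
    refine Finset.sum_eq_zero fun j _ => if_neg ?_
    rintro ⟨h, -⟩
    exact hk (Fin.ext h).symm
  · simp

/-- The exponent of the product of the `α` variables which replace the variable with labels `k`,
`a` in a subdivision. -/
noncomputable def blockExponent (α k a : ℕ) : Φ.Var →₀ ℕ :=
  ∑ j ∈ Finset.range α, Φ.varExponent k (α * a + j)

theorem disjoint_blockExponent (α : ℕ) {k l : ℕ} (a b : ℕ) (h : k ≠ l) :
    Disjoint (Φ.blockExponent α k a) (Φ.blockExponent α l b) := by
  classical
  rw [Finsupp.disjoint_iff, Finset.disjoint_left]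
  intro v hv hv'
  obtain ⟨j, -, hj⟩ := Finset.mem_biUnion.mp (Finsupp.support_finsetSum hv)
  obtain ⟨i, -, hi⟩ := Finset.mem_biUnion.mp (Finsupp.support_finsetSum hv')
  rw [Finsupp.mem_support_iff, varExponent_apply] at hj hi
  exact h ((ite_ne_right_iff.mp hj).1.1.symm.trans (ite_ne_right_iff.mp hi).1.1)

theorem sum_blockExponent (α k m : ℕ) :
    ∑ a ∈ Finset.range m, Φ.blockExponent α k a =
      ∑ j ∈ Finset.range (α * m), Φ.varExponent k j := by
  induction m with
  | zero => simp
  | succ m ih => rw [Finset.sum_range_succ, ih, Nat.mul_succ, Finset.sum_range_add]; rfl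

/-- The Ferrers diagram of all boxes `i` with `∑ k, i k < c`. -/
def simplex (p c : ℕ) (hc : 0 < c) : FerrerDiagram p where
  boxes := {i | ∑ k, i k < c}
  finite := by
    refine (Set.finite_Iic fun _ : Fin p => c).subset fun i hi k => ?_
    have : i k ≤ ∑ k, i k := Finset.single_le_sum (fun _ _ => Nat.zero_le _) (Finset.mem_univ k)
    exact this.trans (le_of_lt hi)
  nonempty := ⟨fun _ => 0, by simpa using hc⟩
  isLowerSet := fun _ _ h hi => lt_of_le_of_lt (Finset.sum_le_sum fun k _ => h k) hi

theorem ext_boxes {Φ Ψ : FerrerDiagram p} (h : Φ.boxes = Ψ.boxes) : Φ = Ψ := by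
  cases Φ; cases Ψ; cases h; rfl

/-- The depth bounds the diagram from above and the codimension bounds it from below. -/
theorem eq_simplex (hp : 0 < p) {c : ℕ} (hc : 0 < c) {Φ : FerrerDiagram p}
    (h : Φ.IsCohenMacaulayOfCodim K c) : Φ = simplex p c hc := by
  refine ext_boxes (Set.ext fun i => ⟨fun hi => Φ.sum_lt_of_isCohenMacaulay hp h hi, fun hi => ?_⟩)
  by_contra hcon
  exact absurd (Φ.le_sum_of_hasCodim h.2 hcon) (not_le.mpr hi)

theorem exists_var_simplex {c : ℕ} (hc : 0 < c) (k : Fin p) {a : ℕ} (ha : a < c) :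
    ∃ v : (simplex p c hc).Var, v.1 = (k, a) :=
  ⟨⟨(k, a), Pi.single k a, by
    change ∑ l, (Pi.single k a : Fin p → ℕ) l < c
    rwa [Finset.sum_pi_single' k a Finset.univ, if_pos (Finset.mem_univ k)], Pi.single_eq_same _ _⟩,
    rfl⟩

theorem ideal_simplex {c : ℕ} (hc : 0 < c) : (simplex p c hc).ideal K =
    monomialIdeal K (simplexExponents (simplex p c hc).varExponent p c) := by
  rw [ideal, monomialIdeal]
  congr 1
  ext f
  constructor
  · rintro ⟨i, rfl⟩
    refine ⟨_, ⟨i.1, i.2, rfl⟩, ?_⟩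
    beta_reduce
    rw [prod_X_boxVar]
    congr 2
    exact Finset.sum_congr rfl fun k _ => varExponent_var _ (boxVar _ i k)
  · rintro ⟨_, ⟨i, hi, rfl⟩, rfl⟩
    refine ⟨⟨i, hi⟩, ?_⟩
    beta_reduce
    rw [prod_X_boxVar]
    congr 2
    exact Finset.sum_congr rfl fun k _ =>
      (varExponent_var _ (boxVar (simplex p c hc) ⟨i, hi⟩ k)).symm

theorem ideal_le_span_X (hp : 0 < p) : Φ.ideal K ≤ Ideal.span (Set.range X) := by
  rw [ideal, Ideal.span_le]
  rintro _ ⟨i, rfl⟩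
  exact Ideal.mem_of_dvd _ (Finset.dvd_prod_of_mem _ (Finset.mem_univ ⟨0, hp⟩))
    (Ideal.subset_span ⟨_, rfl⟩)

theorem isCohenMacaulayOfCodim_simplex (hp : 0 < p) {c : ℕ} (hc : 0 < c) :
    (simplex p c hc).IsCohenMacaulayOfCodim K c := by
  classical
  set Φ := simplex p c hc with hΦ
  let inst : Fintype Φ.Var := Fintype.ofFinite _
  have hne : (1 : MvPolynomial Φ.Var K) ∉ Ideal.span (Set.range X) := by
    intro h
    rw [← Set.image_univ, mem_ideal_span_X_image] at h
    obtain ⟨v, -, hv⟩ := h 0 (by rw [mem_support_iff, coeff_zero_one]; exact one_ne_zero)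
    simp at hv
  have hle := Φ.ideal_le_span_X (K := K) hp
  have hup : ringKrullDim (MvPolynomial Φ.Var K ⧸ Φ.ideal K) + c ≤ Nat.card Φ.Var :=
    Φ.ringKrullDim_add_le fun m hm => not_lt.mp hm
  -- The point (c, 0, …, 0) is a non-box of least label sum, so the dimension is at least |Var| - c.
  let m : Fin p → ℕ := Pi.single ⟨0, hp⟩ c
  have hmsum : ∑ k, m k = c := by
    rw [Finset.sum_pi_single' _ c Finset.univ, if_pos (Finset.mem_univ _)]
  have hm : m ∉ Φ.boxes := fun h => (lt_irrefl c) (by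
    have h' : ∑ k, m k < c := h
    rwa [hmsum] at h')
  let Z : Finset Φ.Var := Finset.univ.filter fun v => v.1.2 < m v.1.1
  have hZ : Z.card ≤ c := hmsum ▸ Φ.card_le_sum fun v hv => by simpa [Z] using hv
  have hlow := natCard_le_ringKrullDim_quotient_add (K := K)
    (Φ.ideal_le_of_notMem hm (Z := Z) fun v hv => by simpa [Z] using hv)
  have hnt : Nontrivial (MvPolynomial Φ.Var K ⧸ Φ.ideal K) :=
    Ideal.Quotient.nontrivial_iff.mpr fun h => hne (hle (h ▸ Submodule.mem_top))
  have hnn := ringKrullDim_nonneg_of_nontrivial (R := MvPolynomial Φ.Var K ⧸ Φ.ideal K)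
  obtain ⟨D, hD, hDn⟩ : ∃ D : ℕ, ringKrullDim (MvPolynomial Φ.Var K ⧸ Φ.ideal K) = D ∧
      D + c = Nat.card Φ.Var := by
    generalize ringKrullDim (MvPolynomial Φ.Var K ⧸ Φ.ideal K) = d at hup hlow hnn
    induction d using WithBot.recBotCoe with
    | bot => simp at hnn
    | coe d =>
      induction d using ENat.recTopCoe with
      | top =>
        exfalso
        have : (⊤ : ℕ∞) + c ≤ (Nat.card Φ.Var : ℕ) := by exact_mod_cast hup
        simp at this
      | coe d =>
        norm_cast at hup hlow
        exact ⟨d, rfl, by omega⟩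
  refine ⟨⟨esymmList K Φ.Var D, fun r hr => mem_span_X_of_mem_esymmList hr, ⟨?_, ?_⟩, ?_⟩, ?_⟩
  · have h := idealRegular_simplexExponents (K := K) (E := Φ.varExponent)
      (fun k l a b h => Φ.disjoint_varExponent h) (n := p) (N := c)
      (fun k hk a ha => by
        obtain ⟨v, hv⟩ := exists_var_simplex hc ⟨k, hk⟩ ha
        refine ⟨v, ?_⟩
        rw [← Φ.varExponent_var v, hv]) p le_rfl c le_rfl (D := D) (Z := ∅) (by simp)
      (by rw [Finset.card_empty, ← Nat.card_eq_fintype_card]; omega)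
    rw [Finset.coe_empty, Set.image_empty, Ideal.span_empty, bot_sup_eq, ← ideal_simplex] at h
    exact h.isWeaklyRegular
  -- Regularity also requires a nonzero final quotient: the sequence and I_Φ both lie in the ideal
  -- of the variables, which does not contain 1.
  · intro h
    have h1 : Ideal.ofList (esymmList K Φ.Var D) ≤ Ideal.span (Set.range X) := by
      rw [Ideal.ofList, Ideal.span_le]
      exact fun r hr => mem_span_X_of_mem_esymmList hr
    have h2 : ∀ y ∈ Ideal.ofList (esymmList K Φ.Var D) •
        (⊤ : Submodule (MvPolynomial Φ.Var K) (MvPolynomial Φ.Var K ⧸ Φ.ideal K)),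
        y ∈ Submodule.map (Submodule.mkQ (Φ.ideal K)) (Ideal.span (Set.range X)) := by
      intro y hy
      refine Submodule.smul_induction_on hy ?_ fun _ _ => Submodule.add_mem _
      rintro r hr y -
      obtain ⟨f, rfl⟩ := Submodule.mkQ_surjective _ y
      exact ⟨r * f, Ideal.mul_mem_right _ _ (h1 hr), rfl⟩
    obtain ⟨f, hf, e⟩ := h2 (Submodule.mkQ (Φ.ideal K) 1) (h ▸ Submodule.mem_top)
    have h3 : f - 1 ∈ Φ.ideal K := (Submodule.Quotient.eq _).mp e
    exact hne (by simpa using sub_mem hf (hle h3))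
  · rw [Module.supportDim_quotient_eq_ringKrullDim, length_esymmList, hD]
  · rw [HasCodim, Module.supportDim_quotient_eq_ringKrullDim, hD, ← hDn]
    push_cast
    rfl

end FerrerDiagram

/-! ### The Alexander dual of the subdivided simplex -/

theorem exists_le_sum_eq_of_le_sum {ι : Type*} [Fintype ι] {q : ι → ℕ} {c : ℕ}
    (h : c ≤ ∑ k, q k) : ∃ r ≤ q, ∑ k, r k = c := by
  classical
  induction c with
  | zero => exact ⟨0, fun _ => Nat.zero_le _, by simp⟩
  | succ c ih =>
    obtain ⟨r, hr, hrc⟩ := ih (Nat.le_of_succ_le h)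
    obtain ⟨k, -, hk⟩ := Finset.exists_lt_of_sum_lt (hrc.trans_lt h)
    refine ⟨r + Pi.single k 1, fun l => ?_, ?_⟩
    · rcases eq_or_ne l k with rfl | hl
      · simpa using hk
      · simpa [hl] using hr l
    · simp [Finset.sum_add_distrib, hrc]

namespace FerrerDiagram

variable {p : ℕ} {K : Type*} [Field K]

section Dual

variable {c α : ℕ} (hc : 0 < c) (hα : 0 < α)

/-- Take for m_k the first label of colour k not represented in F: the monomial of a box m would
have no factor in F. -/
theorem exists_notMem_boxes_of_ideal_le (Φ : FerrerDiagram p) {F : Finset Φ.Var}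
    (h : Φ.ideal K ≤ Ideal.span (X '' (F : Set Φ.Var))) :
    ∃ m : Fin p → ℕ, m ∉ Φ.boxes ∧ ∀ v : Φ.Var, v.1.2 < m v.1.1 → v ∈ F := by
  classical
  have hex : ∀ k : Fin p, ∃ j : ℕ, ∀ v ∈ F, v.1 ≠ (k, j) := by
    intro k
    obtain ⟨j, hj⟩ := Infinite.exists_notMem_finset (F.image fun v => v.1.2)
    exact ⟨j, fun v hv e => hj (Finset.mem_image.mpr ⟨v, hv, congrArg Prod.snd e⟩)⟩
  refine ⟨fun k => Nat.find (hex k), fun hm => ?_, fun v hv => ?_⟩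
  · have h1 := h (Ideal.subset_span ⟨⟨_, hm⟩, rfl⟩)
    beta_reduce at h1
    rw [prod_X_boxVar, mem_ideal_span_X_image] at h1
    obtain ⟨v, hv, hne⟩ := h1 _ (by
      rw [support_monomial, if_neg one_ne_zero]
      exact Finset.mem_singleton_self _)
    rw [Finsupp.finsetSum_apply] at hne
    obtain ⟨k, -, hk⟩ := Finset.exists_ne_zero_of_sum_ne_zero hne
    have e : Φ.boxVar ⟨_, hm⟩ k = v := by
      by_contra hcon
      exact hk (Finsupp.single_eq_of_ne fun e => hcon e.symm)
    exact Nat.find_spec (hex k) v hv (by rw [← e]; rfl)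
  · have h1 := Nat.find_min (hex v.1.1) hv
    push Not at h1
    obtain ⟨u, hu, e⟩ := h1
    rwa [← Subtype.ext (a1 := u) (a2 := v) e]

theorem alexanderDual_subdivide_simplex :
    alexanderDual (((simplex p c hc).subdivide α hα).ideal K) =
      monomialIdeal K
        (dualExponents (((simplex p c hc).subdivide α hα).blockExponent α) p c) := by
  classical
  set Ψ := (simplex p c hc).subdivide α hα with hΨ
  let inst : Fintype Ψ.Var := Fintype.ofFinite _
  have hprod : ∀ F : Finset Ψ.Var, (∏ v ∈ F, X v : MvPolynomial Ψ.Var K) =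
      monomial (∑ v ∈ F, Finsupp.single v 1) 1 := fun F => by rw [monomial_sum_one]; rfl
  have hexp : ∀ m : Fin p → ℕ, ∑ k, ∑ a ∈ Finset.range (m k), Ψ.blockExponent α k a =
      ∑ v ∈ Finset.univ.filter (fun v : Ψ.Var => v.1.2 < α * m v.1.1), Finsupp.single v 1 := by
    intro m
    rw [← Ψ.sum_varExponent fun k => α * m k]
    exact Finset.sum_congr rfl fun k _ => Ψ.sum_blockExponent α k (m k)
  refine le_antisymm (Ideal.span_le.mpr ?_) (Ideal.span_le.mpr ?_)
  · rintro _ ⟨F, hF, rfl⟩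
    obtain ⟨m, hm, hmF⟩ := Ψ.exists_notMem_boxes_of_ideal_le hF
    have hm' : c ≤ ∑ k, m k / α := not_lt.mp hm
    -- The runs in F are cut down to whole blocks, r_k ≤ ⌊m_k / α⌋ of them in colour k, with exactly
    -- c blocks altogether.
    obtain ⟨r, hr, hrc⟩ := exists_le_sum_eq_of_le_sum hm'
    rw [SetLike.mem_coe, hprod, mem_monomialIdeal]
    intro e he
    rw [Finset.mem_singleton.mp (support_monomial_subset he)]
    refine ⟨_, ⟨r, hrc, rfl⟩, ?_⟩
    rw [hexp]
    refine Finset.sum_le_sum_of_subset fun v hv => hmF v ?_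
    have h1 : v.1.2 < α * r v.1.1 := (Finset.mem_filter.mp hv).2
    exact h1.trans_le ((Nat.mul_le_mul_left α (hr v.1.1)).trans (Nat.mul_div_le _ _))
  · rintro _ ⟨_, ⟨m, hm, rfl⟩, rfl⟩
    refine Ideal.subset_span ⟨Finset.univ.filter (fun v : Ψ.Var => v.1.2 < α * m v.1.1), ?_, ?_⟩
    · refine Ψ.ideal_le_of_notMem (m := fun k => α * m k) ?_ fun v hv => by simpa using hv
      intro h
      have h1 : ∑ k, α * m k / α < c := h
      simp only [Nat.mul_div_cancel_left _ hα, hm, lt_irrefl] at h1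
    · beta_reduce
      rw [hprod, hexp]

theorem exists_var_subdivide_simplex (k : Fin p) {a j : ℕ} (ha : a < c) (hj : j < α) :
    ∃ v : ((simplex p c hc).subdivide α hα).Var, v.1 = (k, α * a + j) := by
  refine ⟨⟨(k, α * a + j), Pi.single k (α * a + j), ?_, Pi.single_eq_same _ _⟩, rfl⟩
  change ∑ l, (Pi.single k (α * a + j) : Fin p → ℕ) l / α < c
  rw [Finset.sum_eq_single k]
  · rwa [Pi.single_eq_same, Nat.mul_add_div hα, Nat.div_eq_of_lt hj, add_zero]
  · intro l _ hl
    rw [Pi.single_eq_of_ne hl, Nat.zero_div]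
  · simp

theorem degree_blockExponent_subdivide_simplex {k a : ℕ} (hk : k < p) (ha : a < c) :
    (((simplex p c hc).subdivide α hα).blockExponent α k a).degree = α := by
  set Ψ := (simplex p c hc).subdivide α hα with hΨ
  rw [blockExponent, map_sum, Finset.sum_congr rfl (g := fun _ => 1), Finset.sum_const,
    Finset.card_range, smul_eq_mul, mul_one]
  intro j hj
  obtain ⟨v, hv⟩ := exists_var_subdivide_simplex hc hα ⟨k, hk⟩ ha (Finset.mem_range.mp hj)
  have h := Ψ.varExponent_var v
  rw [hv] at h
  rw [h, Finsupp.degree_single]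

/-- The linear resolution of the dual ideal starts in degree cα with steps of α; prefixing S shifts
its indices by one. -/
theorem hasPureResolution_subdivide_simplex :
    HasPureResolution ((simplex p c hc).subdivide α hα).Var
      (quotientGrading (alexanderDual (((simplex p c hc).subdivide α hα).ideal K)))
      p (fun i => if i = 0 then 0 else (c + i - 1) * α)
      (fun i => if i = 0 then 1 else dualBetti p c (i - 1)) := by
  rw [alexanderDual_subdivide_simplex]
  obtain ⟨P, hP⟩ := exists_linearResolution_dualExponents (K := K)
    (E := ((simplex p c hc).subdivide α hα).blockExponent α)
    (fun k l a b h => disjoint_blockExponent _ α a b h) (n := p) (N := c)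
    (fun k hk a ha => degree_blockExponent_subdivide_simplex hc hα hk ha) p le_rfl c le_rfl
  refine P.hasPureResolution ?_ rfl ?_ ?_ ?_ ?_
  · intro i _
    rcases i with _ | i
    · simpa using Nat.mul_pos hc hα
    · simp only [Nat.add_eq_zero_iff, one_ne_zero, and_false, if_false]
      exact Nat.mul_lt_mul_of_pos_right (by omega) hα
  · simp
  · intro i
    simp only [Nat.add_eq_zero_iff, one_ne_zero, OfNat.ofNat_ne_zero, and_false, if_false]
    rw [show c + (i + 2) - 1 = (c + (i + 1) - 1) + 1 by omega, Nat.add_one_mul]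
  · intro i
    rw [P.card_augIndex]
    simp only [hP]
  · intro i
    rcases i with _ | i
    · simp
    · obtain ⟨c, rfl⟩ := Nat.exists_eq_add_one.mpr hc
      simp only [Nat.add_eq_zero_iff, one_ne_zero, and_false, if_false, Nat.add_sub_cancel]
      rw [dualBetti_pos_iff, Nat.lt_iff_add_one_le]

end Dual

end FerrerDiagram

/-! ### Going up and Noether normalization for modules -/

theorem ringKrullDim_le_of_isIntegral {R S : Type*} [CommRing R] [CommRing S] [Algebra R S]
    [Algebra.IsIntegral R S] (h : Function.Injective (algebraMap R S)) :
    ringKrullDim R ≤ ringKrullDim S := by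
  refine iSup_le fun l => ?_
  obtain ⟨Q, -, hQ, e⟩ := Ideal.exists_ideal_over_prime_of_isIntegral (S := S) l.head.asIdeal ⊥ (by
    rw [← RingHom.ker_eq_comap_bot, (RingHom.injective_iff_ker_eq_bot _).mp h]
    exact bot_le)
  have : Q.LiesOver l.head.asIdeal := ⟨e.symm⟩
  obtain ⟨L, hL, -⟩ := Ideal.exists_ltSeries_of_hasGoingUp l Q
  rw [← hL]
  exact le_iSup (fun L : LTSeries (PrimeSpectrum S) => (L.length : WithBot ℕ∞)) L

theorem RingHom.Finite.exists_sum_mul {R S : Type*} [CommRing R] [CommRing S] {f : R →+* S}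
    (h : f.Finite) : ∃ (n : ℕ) (u : Fin n → S), ∀ x, ∃ c : Fin n → R, ∑ i, f (c i) * u i = x := by
  algebraize [f]
  obtain ⟨n, u, hu⟩ := Module.Finite.exists_fin (R := R) (M := S)
  refine ⟨n, u, fun x => ?_⟩
  obtain ⟨c, hc⟩ := (Submodule.mem_span_range_iff_exists_fun R).mp
    (hu ▸ Submodule.mem_top : x ∈ Submodule.span R (Set.range u))
  simp only [Algebra.smul_def] at hc
  exact ⟨c, hc⟩

theorem RingHom.IsIntegral.ringKrullDim_le {R S : Type*} [CommRing R] [CommRing S] {f : R →+* S}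
    (h : f.IsIntegral) (hf : Function.Injective f) : ringKrullDim R ≤ ringKrullDim S := by
  algebraize [f]
  exact ringKrullDim_le_of_isIntegral hf

section NoetherNormalization

variable {K : Type*} [Field K] {σ : Type*} [Finite σ] {M : Type*} [AddCommGroup M]
  [Module (MvPolynomial σ K) M]

/-- Noether normalization for modules: a finitely generated module `M` over a polynomial ring is
finitely generated over a polynomial ring in at most `dim M` variables. -/
theorem exists_aeval_finite_of_supportDim [Nontrivial M] [Module.Finite (MvPolynomial σ K) M] :
    ∃ (s : ℕ) (φ : MvPolynomial (Fin s) K →ₐ[K] MvPolynomial σ K) (r : ℕ) (m : Fin r → M),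
      (s : WithBot ℕ∞) ≤ Module.supportDim (MvPolynomial σ K) M ∧
      ∀ x : M, ∃ c : Fin r → MvPolynomial (Fin s) K, x = ∑ k, φ (c k) • m k := by
  set I := Module.annihilator (MvPolynomial σ K) M with hI
  have hnt : Nontrivial (MvPolynomial σ K ⧸ I) := by
    refine Ideal.Quotient.nontrivial_iff.mpr fun h => ?_
    obtain ⟨x, hx⟩ := exists_ne (0 : M)
    refine hx ?_
    have h1 : (1 : MvPolynomial σ K) ∈ I := h ▸ Submodule.mem_top
    simpa using Module.mem_annihilator.mp h1 x
  obtain ⟨s, g, hg, hfin⟩ := exists_finite_inj_algHom_of_fg K (MvPolynomial σ K ⧸ I)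
  -- The normalization of S/ann M is lifted to S by arbitrary preimages of the variables. The lift
  -- need not respect degrees; the errors lie in the annihilator and do not act on M.
  choose y hy using fun i => Ideal.Quotient.mk_surjective (I := I) (g (X i))
  have hφ : ∀ a, Ideal.Quotient.mk I (aeval y a) = g a := by
    intro a
    have e : (Ideal.Quotient.mkₐ K I).comp (aeval y) = g := by
      ext i
      simpa using hy i
    exact DFunLike.congr_fun e a
  obtain ⟨n, u, hu⟩ := hfin.exists_sum_mul
  obtain ⟨l, h, hh⟩ := Module.Finite.exists_fin (R := MvPolynomial σ K) (M := M)
  choose w hw using fun j => Ideal.Quotient.mk_surjective (I := I) (u j)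
  have key : ∀ x : M, ∃ c : Fin n × Fin l → MvPolynomial (Fin s) K,
      x = ∑ k, aeval y (c k) • w k.1 • h k.2 := by
    intro x
    obtain ⟨f, hf⟩ := (Submodule.mem_span_range_iff_exists_fun _).mp
      (hh ▸ Submodule.mem_top : x ∈ Submodule.span _ (Set.range h))
    choose c hc using fun j => hu (Ideal.Quotient.mk I (f j))
    refine ⟨fun k => c k.2 k.1, ?_⟩
    rw [← hf, Fintype.sum_prod_type_right]
    refine Finset.sum_congr rfl fun j _ => ?_
    have h1 : f j - ∑ i, aeval y (c j i) * w i ∈ I := by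
      rw [← Ideal.Quotient.mk_eq_mk_iff_sub_mem, ← hc, map_sum]
      refine Finset.sum_congr rfl fun i _ => ?_
      rw [map_mul, hφ, hw]
      rfl
    have h2 := Module.mem_annihilator.mp h1 (h j)
    rw [sub_smul, sub_eq_zero, Finset.sum_smul] at h2
    rw [h2]
    exact Finset.sum_congr rfl fun i _ => mul_smul _ _ _
  refine ⟨s, aeval y, _, fun k => w (finProdFinEquiv.symm k).1 • h (finProdFinEquiv.symm k).2,
    ?_, fun x => ?_⟩
  · rw [Module.supportDim_eq_ringKrullDim_quotient_annihilator, ← hI]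
    refine le_trans (le_of_eq ?_) (hfin.to_isIntegral.ringKrullDim_le hg)
    rw [MvPolynomial.ringKrullDim_of_isNoetherianRing, ringKrullDim_eq_zero_of_field]
    simp
  · obtain ⟨c, hc⟩ := key x
    refine ⟨fun k => c (finProdFinEquiv.symm k), hc.trans ?_⟩
    exact (Equiv.sum_comp finProdFinEquiv.symm
      fun k => aeval y (c k) • w k.1 • h k.2).symm

end NoetherNormalization

/-! ### Growth of the Hilbert function -/

section Filtration

variable {K : Type*} [Field K] {σ : Type*} {M : Type*} [AddCommGroup M] [Module K M]
  [Module (MvPolynomial σ K) M] {s r : ℕ}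

/-- The span of the elements `φ c • m k` for the polynomials `c` of degree at most `e` in each
variable. -/
def degreeFiltration (φ : MvPolynomial (Fin s) K →ₐ[K] MvPolynomial σ K) (m : Fin r → M) (e : ℕ) :
    Submodule K M :=
  Submodule.span K {x | ∃ c k, (∀ i, degreeOf i c ≤ e) ∧ x = φ c • m k}

variable {φ : MvPolynomial (Fin s) K →ₐ[K] MvPolynomial σ K} {m : Fin r → M}

theorem degreeFiltration_mono : Monotone (degreeFiltration φ m) := fun _ _ h =>
  Submodule.span_mono fun _ ⟨c, k, hc, hx⟩ => ⟨c, k, fun i => (hc i).trans h, hx⟩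

variable [IsScalarTower K (MvPolynomial σ K) M]

theorem degreeFiltration_le_span (e : ℕ) : degreeFiltration φ m e ≤
    Submodule.span K (Set.range fun q : Fin r × (Fin s → Fin (e + 1)) =>
      φ (monomial (Finsupp.equivFunOnFinite.symm fun i => (q.2 i : ℕ)) 1) • m q.1) := by
  rw [degreeFiltration, Submodule.span_le]
  rintro _ ⟨c, k, hc, rfl⟩
  rw [SetLike.mem_coe, c.as_sum, map_sum, Finset.sum_smul]
  refine Submodule.sum_mem _ fun u hu => ?_
  rw [← mul_one (coeff u c), ← smul_eq_mul, ← smul_monomial, map_smul, smul_assoc]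
  refine Submodule.smul_mem _ _ (Submodule.subset_span
    ⟨(k, fun i => ⟨u i, Nat.lt_succ_of_le ((monomial_le_degreeOf i hu).trans (hc i))⟩), ?_⟩)
  beta_reduce
  congr 3
  exact congrArg monomial (Finsupp.ext fun i => rfl)

instance (e : ℕ) : FiniteDimensional K (degreeFiltration φ m e) :=
  have : FiniteDimensional K _ := FiniteDimensional.span_of_finite K (Set.finite_range
    fun q : Fin r × (Fin s → Fin (e + 1)) =>
      φ (monomial (Finsupp.equivFunOnFinite.symm fun i => (q.2 i : ℕ)) 1) • m q.1)
  Submodule.finiteDimensional_of_le (degreeFiltration_le_span e)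

theorem finrank_degreeFiltration_le (e : ℕ) :
    Module.finrank K (degreeFiltration φ m e) ≤ r * (e + 1) ^ s := by
  have : FiniteDimensional K _ := FiniteDimensional.span_of_finite K (Set.finite_range
    fun q : Fin r × (Fin s → Fin (e + 1)) =>
      φ (monomial (Finsupp.equivFunOnFinite.symm fun i => (q.2 i : ℕ)) 1) • m q.1)
  refine (Submodule.finrank_mono (degreeFiltration_le_span e)).trans
    ((finrank_range_le_card _).trans (le_of_eq ?_))
  simp

omit [IsScalarTower K (MvPolynomial σ K) M] in
theorem sum_smul_mem_degreeFiltration {e : ℕ} (c : Fin r → MvPolynomial (Fin s) K)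
    (hc : ∀ k i, degreeOf i (c k) ≤ e) : ∑ k, φ (c k) • m k ∈ degreeFiltration φ m e :=
  Submodule.sum_mem _ fun k _ => Submodule.subset_span ⟨c k, k, hc k, rfl⟩

omit [Module K M] [IsScalarTower K (MvPolynomial σ K) M] in
theorem exists_mem_degreeFiltration {ι : Type*} [Finite ι]
    (hm : ∀ x : M, ∃ c : Fin r → MvPolynomial (Fin s) K, x = ∑ k, φ (c k) • m k) (x : ι → M) :
    ∃ e, ∀ j, ∃ c : Fin r → MvPolynomial (Fin s) K,
      (∀ k i, degreeOf i (c k) ≤ e) ∧ x j = ∑ k, φ (c k) • m k := by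
  have := Fintype.ofFinite ι
  choose c hc using fun j => hm (x j)
  refine ⟨∑ j, ∑ k, ∑ i, degreeOf i (c j k), fun j => ⟨c j, fun k i => ?_, hc j⟩⟩
  exact ((Finset.single_le_sum (f := fun i => degreeOf i (c j k))
    (fun _ _ => Nat.zero_le _) (Finset.mem_univ i)).trans
    (Finset.single_le_sum (f := fun k => ∑ i, degreeOf i (c j k))
      (fun _ _ => Nat.zero_le _) (Finset.mem_univ k))).trans
    (Finset.single_le_sum (f := fun j => ∑ k, ∑ i, degreeOf i (c j k))
      (fun _ _ => Nat.zero_le _) (Finset.mem_univ j))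

/-- Each x_v • m_k is a combination of the m_l with coefficients of bounded degree. Since finitely
many pairs occur, one constant C serves for all. -/
theorem exists_X_smul_mem_degreeFiltration [Finite σ]
    (hm : ∀ x : M, ∃ c : Fin r → MvPolynomial (Fin s) K, x = ∑ k, φ (c k) • m k) :
    ∃ C, ∀ v e, ∀ x ∈ degreeFiltration φ m e,
      (X v : MvPolynomial σ K) • x ∈ degreeFiltration φ m (e + C) := by
  obtain ⟨C, hC⟩ := exists_mem_degreeFiltration hm
    fun q : σ × Fin r => (X q.1 : MvPolynomial σ K) • m q.2
  refine ⟨C, fun v e x hx => ?_⟩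
  induction hx using Submodule.span_induction with
  | zero => rw [smul_zero]; exact Submodule.zero_mem _
  | add x y _ _ hx hy => rw [smul_add]; exact Submodule.add_mem _ hx hy
  | smul a x _ hx =>
    rw [smul_comm]
    exact Submodule.smul_mem _ _ hx
  | mem x hx =>
    obtain ⟨c, k, hc, rfl⟩ := hx
    obtain ⟨d, hd, e⟩ := hC (v, k)
    rw [smul_comm, e, Finset.smul_sum]
    simp only [smul_smul, ← map_mul]
    exact sum_smul_mem_degreeFiltration _ fun l i =>
      (degreeOf_mul_le _ _ _).trans (add_le_add (hc i) (hd l i))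

theorem monomial_smul_mem_degreeFiltration {C : ℕ}
    (hC : ∀ v e, ∀ x ∈ degreeFiltration φ m e,
      (X v : MvPolynomial σ K) • x ∈ degreeFiltration φ m (e + C)) (u : σ →₀ ℕ) (a : K) {e : ℕ}
    {x : M} (hx : x ∈ degreeFiltration φ m e) :
    monomial u a • x ∈ degreeFiltration φ m (e + C * u.degree) := by
  induction hd : u.degree generalizing u with
  | zero =>
    rw [(Finsupp.degree_eq_zero_iff u).mp hd, mul_zero, add_zero, ← C_apply, ← algebraMap_eq,
      algebraMap_smul]
    exact Submodule.smul_mem _ _ hx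
  | succ d ih =>
    obtain ⟨v, hv⟩ : ∃ v, u v ≠ 0 := by
      by_contra! h
      rw [show u = 0 from Finsupp.ext h, map_zero] at hd
      exact absurd hd (by omega)
    have hu : Finsupp.single v 1 + (u - Finsupp.single v 1) = u :=
      add_tsub_cancel_of_le (Finsupp.single_le_iff.mpr (Nat.one_le_iff_ne_zero.mpr hv))
    have hdeg := congrArg Finsupp.degree hu
    rw [map_add, Finsupp.degree_single, hd] at hdeg
    rw [← hu, monomial_single_add, pow_one, mul_smul, Nat.mul_succ, ← add_assoc]
    exact hC _ _ _ (ih _ (by omega))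

end Filtration

section GradedGrowth

variable {K : Type*} [Field K] {σ : Type*} {M : Type*} [AddCommGroup M] [Module K M]
  [Module (MvPolynomial σ K) M] (ℳ : ℕ → Submodule K M) [DirectSum.Decomposition ℳ]

theorem exists_homogeneous_generators [Module.Finite (MvPolynomial σ K) M] :
    ∃ (ι : Type) (_ : Finite ι) (h : ι → M) (g : ι → ℕ), (∀ l, h l ∈ ℳ (g l)) ∧
      Submodule.span (MvPolynomial σ K) (Set.range h) = ⊤ := by
  classical
  obtain ⟨n, h, hh⟩ := Module.Finite.exists_fin (R := MvPolynomial σ K) (M := M)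
  refine ⟨Σ j : Fin n, (DirectSum.decompose ℳ (h j)).support, inferInstance,
    fun q => DirectSum.decompose ℳ (h q.1) q.2, fun q => q.2, fun q => SetLike.coe_mem _, ?_⟩
  rw [eq_top_iff, ← hh, Submodule.span_le]
  rintro _ ⟨j, rfl⟩
  rw [SetLike.mem_coe, ← DirectSum.sum_support_decompose ℳ (h j)]
  exact Submodule.sum_mem _ fun i hi => Submodule.subset_span ⟨⟨j, ⟨i, hi⟩⟩, rfl⟩

theorem mem_of_monomial_smul_mem [SetLike.GradedSMul (homogeneousSubmodule σ K) ℳ]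
    {ι : Type*} {h : ι → M} {g : ι → ℕ} (hg : ∀ l, h l ∈ ℳ (g l))
    (hh : Submodule.span (MvPolynomial σ K) (Set.range h) = ⊤) {d : ℕ} {V : Submodule K M}
    (hV : ∀ (u : σ →₀ ℕ) (a : K) (l), u.degree + g l = d → monomial u a • h l ∈ V) :
    ℳ d ≤ V := by
  have key : ∀ x : M, (DirectSum.decompose ℳ x d : M) ∈ V := by
    intro x
    have hx : x ∈ Submodule.span (MvPolynomial σ K) (Set.range h) := hh ▸ Submodule.mem_top
    induction hx using Submodule.closure_induction with
    | zero => rw [DirectSum.decompose_zero]; exact V.zero_mem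
    | add x y _ _ hx hy => rw [DirectSum.decompose_add]; exact V.add_mem hx hy
    | smul_mem f x hx =>
      obtain ⟨l, rfl⟩ := hx
      induction f using MvPolynomial.induction_on' with
      | add f f' hf hf' =>
        rw [add_smul, DirectSum.decompose_add]
        exact V.add_mem hf hf'
      | monomial u a =>
        have h1 : (monomial u a : MvPolynomial σ K) • h l ∈ ℳ (u.degree + g l) :=
          SetLike.GradedSMul.smul_mem (A := homogeneousSubmodule σ K)
            ((mem_homogeneousSubmodule _ _).mpr (isHomogeneous_monomial a rfl)) (hg l)
        by_cases hd : u.degree + g l = d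
        · rw [← hd, DirectSum.decompose_of_mem_same ℳ h1]
          exact hV u a l hd
        · rw [DirectSum.decompose_of_mem_ne ℳ h1 hd]
          exact V.zero_mem
  intro x hx
  rw [← DirectSum.decompose_of_mem_same ℳ hx]
  exact key x

omit [Module (MvPolynomial σ K) M] in
theorem sum_finrank_le_finrank {n : ℕ} {V : Submodule K M} [FiniteDimensional K V]
    (h : ∀ d < n, ℳ d ≤ V) :
    ∑ d ∈ Finset.range n, Module.finrank K (ℳ d) ≤ Module.finrank K V := by
  have hfin : ∀ d : Fin n, FiniteDimensional K (ℳ d) := fun d =>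
    Submodule.finiteDimensional_of_le (h d d.2)
  let f : (∀ d : Fin n, ℳ d) →ₗ[K] V :=
    ∑ d : Fin n, Submodule.inclusion (h d d.2) ∘ₗ LinearMap.proj d
  have hf : Function.Injective f := by
    rw [← LinearMap.ker_eq_bot, LinearMap.ker_eq_bot']
    intro x hx
    have h1 : ∑ d : Fin n, (x d : M) = 0 := by
      have := congrArg V.subtype hx
      simpa [f, LinearMap.sum_apply] using this
    ext d
    have h2 := congrArg (fun y : M => (DirectSum.decompose ℳ y d : M)) h1
    simp only [DirectSum.decompose_sum, DirectSum.decompose_zero, DirectSum.sum_apply,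
      AddSubmonoidClass.coe_finsetSum] at h2
    rw [Finset.sum_eq_single d] at h2
    · rw [DirectSum.decompose_of_mem_same ℳ (x d).2] at h2
      exact h2
    · intro i _ hi
      exact DirectSum.decompose_of_mem_ne ℳ (x i).2 fun e => hi (Fin.ext e)
    · simp
  refine le_trans (le_of_eq ?_) (LinearMap.finrank_le_finrank_of_injective hf)
  rw [Module.finrank_pi_fintype, Finset.sum_range]

/-- The Hilbert function of a finitely generated graded module, summed up to degree `d`, grows at
most like a polynomial in `d` of degree the dimension of the module. -/
theorem exists_sum_finrank_le [Finite σ] [IsScalarTower K (MvPolynomial σ K) M]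
    [Module.Finite (MvPolynomial σ K) M] [Nontrivial M]
    [SetLike.GradedSMul (homogeneousSubmodule σ K) ℳ] :
    ∃ s N : ℕ, (s : WithBot ℕ∞) ≤ Module.supportDim (MvPolynomial σ K) M ∧
      ∀ d, ∑ i ∈ Finset.range (d + 1), Module.finrank K (ℳ i) ≤ N * (d + 1) ^ s := by
  obtain ⟨s, φ, r, m, hs, hm⟩ := exists_aeval_finite_of_supportDim (K := K) (σ := σ) (M := M)
  obtain ⟨ι, _, h, g, hg, hh⟩ := exists_homogeneous_generators (σ := σ) ℳ
  obtain ⟨C, hC⟩ := exists_X_smul_mem_degreeFiltration hm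
  obtain ⟨e, he⟩ := exists_mem_degreeFiltration hm h
  have he' : ∀ l, h l ∈ degreeFiltration φ m e := fun l => by
    obtain ⟨c, hc, hl⟩ := he l
    exact hl ▸ sum_smul_mem_degreeFiltration c hc
  -- All components of degree at most d lie in the step e + Cd of the filtration, and e + Cd + 1 ≤
  -- (e + C + 1)(d + 1).
  refine ⟨s, r * (e + C + 1) ^ s, hs, fun d => ?_⟩
  refine (sum_finrank_le_finrank ℳ (V := degreeFiltration φ m (e + C * d)) fun i hi => ?_).trans
    ((finrank_degreeFiltration_le _).trans ?_)
  · refine mem_of_monomial_smul_mem ℳ hg hh fun u a l hu => ?_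
    exact degreeFiltration_mono (Nat.add_le_add_left (Nat.mul_le_mul_left C (by omega)) e)
      (monomial_smul_mem_degreeFiltration hC u a (he' l))
  · rw [mul_assoc, ← mul_pow]
    exact Nat.mul_le_mul_left _ (Nat.pow_le_pow_left (by nlinarith [Nat.zero_le (e * d)]) s)

end GradedGrowth

/-! ### Vanishing of the Betti polynomial at 1 -/

section BettiPolynomial

open Filter in
theorem Polynomial.natDegree_le_of_eval_le {P : Polynomial ℚ} {N s : ℕ}
    (h : ∀ᶠ d : ℕ in atTop, |P.eval (d : ℚ)| ≤ N * ((d : ℚ) + 1) ^ s) : P.natDegree ≤ s := by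
  by_contra! hs
  set Q : Polynomial ℚ := (Polynomial.X + Polynomial.C 1) ^ s with hQ
  have hQ0 : Q ≠ 0 := pow_ne_zero _ (Polynomial.X_add_C_ne_zero 1)
  have hdeg : Q.degree < P.degree :=
    Polynomial.degree_lt_degree (by rwa [hQ, Polynomial.natDegree_pow, Polynomial.natDegree_X_add_C,
      mul_one])
  have ht := (Polynomial.abs_div_tendsto_atTop_atTop_of_degree_gt P Q hdeg hQ0).comp
    (tendsto_natCast_atTop_atTop (R := ℚ))
  obtain ⟨d, h1, h2⟩ := (h.and (ht.eventually_gt_atTop (N : ℚ))).exists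
  have hpos : (0 : ℚ) < ((d : ℚ) + 1) ^ s := by positivity
  simp only [Function.comp_apply, hQ, Polynomial.eval_pow, Polynomial.eval_add, Polynomial.eval_X,
    Polynomial.eval_C, abs_div, abs_of_pos hpos] at h2
  rw [lt_div_iff₀ hpos] at h2
  exact absurd h1 (not_le.mpr h2)

/-- The partial sums of f are the coefficients of B/(1 - t)^(n + 1). For large d they agree with a
polynomial of degree n minus the order of vanishing of B at 1, when that order is less than k; the
growth bound s ≤ n - k excludes this. -/
theorem sub_one_pow_dvd_of_sum_le {f : ℕ → ℕ} {B : Polynomial ℤ} {n k s N : ℕ}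
    (hB : PowerSeries.mk (fun d => (f d : ℤ)) * (1 - PowerSeries.X) ^ n = (B : PowerSeries ℤ))
    (hf : ∀ d, ∑ i ∈ Finset.range (d + 1), f i ≤ N * (d + 1) ^ s) (hs : s + k ≤ n) :
    (Polynomial.X - Polynomial.C 1) ^ k ∣ B.map (Int.castRingHom ℚ) := by
  set P := B.map (Int.castRingHom ℚ) with hP
  rcases eq_or_ne P 0 with h0 | h0
  · rw [h0]; exact dvd_zero _
  rw [← Polynomial.le_rootMultiplicity_iff h0]
  by_contra! hlt
  have hP' : PowerSeries.mk (fun d => (f d : ℚ)) * (1 - PowerSeries.X) ^ n =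
      (P : PowerSeries ℚ) := by
    have h1 := congrArg (PowerSeries.map (Int.castRingHom ℚ)) hB
    rw [map_mul, map_pow, map_sub, map_one, PowerSeries.map_X,
      ← Polynomial.polynomial_map_coe] at h1
    rw [hP, ← h1]
    congr 1
  have hcoeff : ∀ d, PowerSeries.coeff d
      ((P : PowerSeries ℚ) * (PowerSeries.invOneSubPow ℚ (n + 1)).val) =
      ((∑ i ∈ Finset.range (d + 1), f i : ℕ) : ℚ) := by
    intro d
    rw [← hP', mul_assoc, add_comm n 1,
      PowerSeries.one_sub_pow_mul_invOneSubPow_val_add_eq_invOneSubPow_val,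
      PowerSeries.invOneSubPow_val_succ_eq_mk_add_choose, PowerSeries.coeff_mul,
      Finset.Nat.sum_antidiagonal_eq_sum_range_succ_mk]
    simp
  have hdeg : (Polynomial.hilbertPoly P (n + 1)).natDegree ≤ s := by
    refine Polynomial.natDegree_le_of_eval_le (N := N) ?_
    filter_upwards [Filter.eventually_gt_atTop P.natDegree] with d hd
    rw [← Polynomial.coeff_mul_invOneSubPow_eq_hilbertPoly_eval _ hd, hcoeff,
      abs_of_nonneg (Nat.cast_nonneg _)]
    exact_mod_cast hf d
  rw [Polynomial.natDegree_hilbertPoly_of_ne_zero_of_rootMultiplicity_lt h0 (by omega)] at hdeg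
  omega

/-- A double root at 1 kills both the polynomial and its derivative there. -/
theorem sum_betti_eq_zero {β₀ β₁ β₂ : ℤ} {a₁ a₂ : ℕ}
    (h : (Polynomial.X - Polynomial.C 1) ^ 2 ∣
      (Polynomial.C β₀ - Polynomial.C β₁ * Polynomial.X ^ a₁ +
          Polynomial.C β₂ * Polynomial.X ^ a₂ : Polynomial ℤ).map (Int.castRingHom ℚ)) :
    (β₀ : ℚ) - β₁ + β₂ = 0 ∧ (a₁ : ℚ) * β₁ = a₂ * β₂ := by
  obtain ⟨q, hq⟩ := h
  constructor
  · have h1 := congrArg (Polynomial.eval 1) hq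
    simpa using h1
  · have h1 := congrArg (fun P => Polynomial.eval 1 (Polynomial.derivative P)) hq
    simp [Polynomial.derivative_pow] at h1
    linarith

theorem betti_formulas {K : Type*} [Field K] {σ : Type*} [Finite σ] {M : Type*} [AddCommGroup M]
    [Module K M] [Module (MvPolynomial σ K) M] [IsScalarTower K (MvPolynomial σ K) M]
    [Module.Finite (MvPolynomial σ K) M] {ℳ : ℕ → Submodule K M} [DirectSum.Decomposition ℳ]
    [SetLike.GradedSMul (homogeneousSubmodule σ K) ℳ] (hcodim : HasCodim K σ M 2)
    {a₁ a₂ : ℕ} {β₀ β₁ β₂ : ℤ}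
    (hB : IsBettiPolynomial σ ℳ (Polynomial.C β₀ - Polynomial.C β₁ * Polynomial.X ^ a₁ +
      Polynomial.C β₂ * Polynomial.X ^ a₂)) :
    (β₀ : ℚ) - β₁ + β₂ = 0 ∧ (a₁ : ℚ) * β₁ = a₂ * β₂ := by
  rw [HasCodim] at hcodim
  have hnt : Nontrivial M := by
    rw [← Module.supportDim_ne_bot_iff_nontrivial (MvPolynomial σ K)]
    intro h
    rw [h, WithBot.bot_add] at hcodim
    exact WithBot.bot_ne_coe hcodim
  obtain ⟨s, N, hs, hN⟩ := exists_sum_finrank_le (σ := σ) ℳ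
  have hsn : s + 2 ≤ Nat.card σ := by
    have h := add_le_add_left hs ((2 : ℕ) : WithBot ℕ∞)
    rw [hcodim] at h
    exact_mod_cast h
  exact sum_betti_eq_zero (sub_one_pow_dvd_of_sum_le hB hN hsn)

end BettiPolynomial

theorem mainTheorem9 (K : Type*) [Field K] :
    -- the diagram `Φ(p,c)` and the resolution of the Alexander dual of its subdivision
    (∀ p c : ℕ, 0 < p → 0 < c →
      (∃! Φ : FerrerDiagram p, Φ.IsCohenMacaulayOfCodim K c) ∧
      ∀ Φ : FerrerDiagram p, Φ.IsCohenMacaulayOfCodim K c →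
        ∀ (α : ℕ) (hα : 0 < α), ∃ β : ℕ → ℕ,
          HasPureResolution (Φ.subdivide α hα).Var
            (quotientGrading (alexanderDual ((Φ.subdivide α hα).ideal K)))
            p (fun i => if i = 0 then 0 else (c + i - 1) * α) β) ∧
    -- Betti polynomials of Cohen–Macaulay modules of codimension 2
    (∀ (σ : Type*) [Finite σ] (M : Type*) [AddCommGroup M] [Module K M]
        [Module (MvPolynomial σ K) M] [IsScalarTower K (MvPolynomial σ K) M]
        [Module.Finite (MvPolynomial σ K) M]
        (ℳ : ℕ → Submodule K M) [DirectSum.Decomposition ℳ]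
        [SetLike.GradedSMul (MvPolynomial.homogeneousSubmodule σ K) ℳ],
      IsGradedCohenMacaulay K σ M → HasCodim K σ M 2 →
      ∀ (a₁ a₂ : ℕ) (β₀ β₁ β₂ : ℤ), 0 < a₁ → a₁ < a₂ →
        IsBettiPolynomial σ ℳ (Polynomial.C β₀ - Polynomial.C β₁ * Polynomial.X ^ a₁ +
          Polynomial.C β₂ * Polynomial.X ^ a₂) →
        (β₁ : ℚ) = (a₂ : ℚ) / ((a₂ : ℚ) - (a₁ : ℚ)) * (β₀ : ℚ) ∧
        (β₂ : ℚ) = (a₁ : ℚ) / ((a₂ : ℚ) - (a₁ : ℚ)) * (β₀ : ℚ) ∧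
        (∃ (c : ℚ) (α : ℕ), 0 < c ∧ 0 < α ∧ (a₁ : ℚ) = c * α ∧ (a₂ : ℚ) = (c + 1) * α) ∧
        ((a₂ - a₁) ∣ a₁ → (a₂ - a₁) ∣ a₂ →
          ∃ c α : ℕ, 0 < c ∧ 0 < α ∧ a₁ = c * α ∧ a₂ = (c + 1) * α ∧
            β₁ = ((c : ℤ) + 1) * β₀ ∧ β₂ = (c : ℤ) * β₀)) ∧
    -- realization by direct sums of copies of the duals for `p = 2`
    (∀ c : ℕ, 0 < c → ∀ Φ : FerrerDiagram 2, Φ.IsCohenMacaulayOfCodim K c →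
      ∀ (α : ℕ) (hα : 0 < α) (β₀ : ℕ), 0 < β₀ →
        HasPureResolution (Φ.subdivide α hα).Var
          (copiesGrading (alexanderDual ((Φ.subdivide α hα).ideal K)) β₀)
          2 (fun i => if i = 0 then 0 else (c + i - 1) * α)
          (fun i => if i = 0 then β₀ else if i = 1 then (c + 1) * β₀
            else if i = 2 then c * β₀ else 0)) := by
  classical
  have huniq : ∀ {p c : ℕ} (hp : 0 < p) (hc : 0 < c) {Φ : FerrerDiagram p},
      Φ.IsCohenMacaulayOfCodim K c → Φ = FerrerDiagram.simplex p c hc :=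
    fun hp hc _ h => FerrerDiagram.eq_simplex hp hc h
  refine ⟨fun p c hp hc => ⟨⟨FerrerDiagram.simplex p c hc,
    FerrerDiagram.isCohenMacaulayOfCodim_simplex hp hc, fun Φ h => huniq hp hc h⟩,
    fun Φ h α hα => ?_⟩, ?_, fun c hc Φ h α hα β₀ hβ₀ => ?_⟩
  · obtain rfl := huniq hp hc h
    exact ⟨_, FerrerDiagram.hasPureResolution_subdivide_simplex hc hα⟩
  · intro σ _ M _ _ _ _ _ ℳ _ _ _ hcodim a₁ a₂ β₀ β₁ β₂ h₁ h₁₂ hB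
    obtain ⟨h0, h1⟩ := betti_formulas hcodim hB
    have hd : (0 : ℚ) < (a₂ : ℚ) - a₁ := sub_pos.mpr (by exact_mod_cast h₁₂)
    have h₁' : (0 : ℚ) < a₁ := by exact_mod_cast h₁
    -- The difference of the two degrees must be α, which determines c as a₁ / α.
    refine ⟨?_, ?_, ⟨a₁ / (a₂ - a₁), a₂ - a₁, div_pos h₁' hd, Nat.sub_pos_of_lt h₁₂, ?_, ?_⟩, ?_⟩
    · rw [div_mul_eq_mul_div, eq_div_iff hd.ne']
      linear_combination -(a₂ : ℚ) * h0 - h1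
    · rw [div_mul_eq_mul_div, eq_div_iff hd.ne']
      linear_combination -(a₁ : ℚ) * h0 - h1
    · rw [Nat.cast_sub h₁₂.le, div_mul_cancel₀ _ hd.ne']
    · rw [Nat.cast_sub h₁₂.le, add_one_mul, div_mul_cancel₀ _ hd.ne', add_sub_cancel]
    · rintro ⟨c, hc⟩ -
      have hα : 0 < a₂ - a₁ := Nat.sub_pos_of_lt h₁₂
      have ha₂ : a₂ = (c + 1) * (a₂ - a₁) := by
        rw [Nat.add_one_mul, mul_comm c, ← hc]
        omega
      have hc0 : 0 < c := Nat.pos_of_ne_zero fun e => by simp [e] at hc; omega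
      refine ⟨c, a₂ - a₁, hc0, hα, hc.trans (mul_comm _ _), ha₂, ?_⟩
      have hα' : ((a₂ - a₁ : ℕ) : ℚ) ≠ 0 := by exact_mod_cast hα.ne'
      have e₁ : (a₁ : ℚ) = ((a₂ - a₁ : ℕ) : ℚ) * c := by exact_mod_cast hc
      have e₂ : (a₂ : ℚ) = (c + 1) * ((a₂ - a₁ : ℕ) : ℚ) := by exact_mod_cast ha₂
      have h2 : (c : ℚ) * β₁ = (c + 1) * β₂ := by
        refine mul_left_cancel₀ hα' ?_
        rw [e₁, e₂] at h1
        linear_combination h1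
      constructor
      · have : (β₁ : ℚ) = (c + 1) * β₀ := by linear_combination (-(c : ℚ) - 1) * h0 - h2
        exact_mod_cast this
      · have : (β₂ : ℚ) = c * β₀ := by linear_combination (-(c : ℚ)) * h0 - h2
        exact_mod_cast this
  · obtain rfl := huniq two_pos hc h
    have key := (FerrerDiagram.hasPureResolution_subdivide_simplex (K := K) (p := 2) hc hα).copies
      hβ₀
    convert! key using 2 with i
    rcases i with _ | _ | _ | i <;> simp [dualBetti_two, mul_comm]
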